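/- **Setting.** For real tensors with third dimension $N_3$, let $*$ denote the t-product (matrix product in which entries are tubes in $\mathbb R^{N_3}$ multiplied by circular convolution), $\top$ the tensor transpose (transpose every frontal slice and reverse the order of slices $2,\dots,N_3$), and $\breve{\mathcal A}$ the unnormalised discrete Fourier transform of $\mathcal A$ along the third mode. Let $\mathcal T=\mathcal U*\Theta*\mathcal V^\top\in\mathbb R^{N_1\times N_2\times N_3}$ be a t-SVD ($\mathcal U,\mathcal V$ orthogonal tensors, $\Theta$ f-diagonal with diagonal tubes of decreasing norm), let $r$ be the tubal-rank (the number of non-zero tubes of $\Theta$), and put $$\mu(\mathcal U)=\frac{N_1}{r}\max_{1\le i\le N_1,\ 1\le k\le N_3}\big\|\breve{\mathcal U}^{\top}(:,:,k)\,\mathbf e_i\big\|_F^2 ,$$ where only the first $r$ lateral slices of $\mathcal U$ are used. Given a budget $M>0$, an allocation ratio $\delta\in(0,1)$ and a number of rounds $L$, sample in two passes (sample sizes rounded down). *First pass:* in every column $j\in\{1,\dots,N_2\}$ draw $m=\delta M/N_2$ row indices independently and uniformly (with replacement) from $\{1,\dots,N_1\}$; call the resulting list $\Omega_j^1$. *Second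 pass:* start with $\hat{\mathcal U}=\emptyset$. In each of $L$ rounds, form $$\hat p_j=\frac{\|\mathcal P_{\hat{\mathcal U}_{\Omega_j^1}^{\perp}}(\mathcal T(\Omega_j^1,j,:))\|_F^2}{\sum_{j'=1}^{N_2}\|\mathcal P_{\hat{\mathcal U}_{\Omega_{j'}^1}^{\perp}}(\mathcal T(\Omega_{j'}^1,j',:))\|_F^2},$$ where $\hat{\mathcal U}_{\Omega}$ is the restriction of $\hat{\mathcal U}$ to the rows $\Omega$ and $\mathcal P_{\mathcal A^\perp}$ is the orthogonal projection onto the complement of the t-span of the lateral slices of $\mathcal A$; draw $s=(1-\delta)M/(N_2L)$ columns independently according to $\hat p$ (none if the denominator vanishes), project the selected lateral slices of $\mathcal T$ onto $\hat{\mathcal U}^\perp$, normalise, and append them to $\hat{\mathcal U}$. **Lemma.** For every $\delta\in(0,1)$ there is a constant $C>0$, depending only on $\delta$, such that the following hold. 1. Let $N_1,N_2,N_3\ge 1$, let $\mathcal T$ be as above with tubal-rank $r$ and $\mu(\mathcal U)\le\mu_0$, let $\rho,\epsilon\in(0,1)$, let $L\in\mathbb N$ be arbitrary, and let $$M\ \ge\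 C\,r\,N_2\Big(\mu_0\log\frac{N_2}{\rho}\,\log\frac{rN_2}{\rho}+\frac{\lceil\log(N_1N_2N_3)\rceil^2}{\rho\,\epsilon}\Big).$$ Then, with probability at least $1-6\rho$ over both passes, the following holds simultaneously for every $\hat{\mathcal U}$ that occurs in the course of the second pass (before, between and after the $L$ rounds) and every $j\in\{1,\dots,N_2\}$: with $\mathcal E=\mathcal P_{\hat{\mathcal U}^\perp}(\mathcal T)$, if $\mathcal E\neq0$, then $$\frac25\cdot\frac{\|\mathcal E(:,j,:)\|_F^2}{\|\mathcal E\|_F^2}\ \le\ \hat p_j\ \le\ \frac52\cdot\frac{\|\mathcal E(:,j,:)\|_F^2}{\|\mathcal E\|_F^2}.$$ 2. The required budget is $O(Nr\log^2N)$ with $N=\max(N_1,N_2)$: for all $\mu_0>0$ and $\rho,\epsilon\in(0,1)$ there is $K>0$, such that for all $N_1,N_2,N_3\ge1$ with $N\ge2$, $N_3\le N$ and $r\le\min(N_1,N_2)$, the right-hand side of the condition on $M$ in part 1 is at most $K\,N\,r\log^2N$. -/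

import Mathlib

/-! Third-order tensors, the t-product and the t-SVD -/

/-- A real tensor of size `N₁ × N₂ × N₃`. The third (tube) index runs over `ℤ/N₃`, so that the
circular convolution of tubes and the discrete Fourier transform are the usual ones. -/
abbrev Tensor (N₁ N₂ N₃ : ℕ) : Type := Fin N₁ → Fin N₂ → ZMod N₃ → ℝ

namespace Tensor

variable {N₁ N₂ N₃ N₄ : ℕ} [NeZero N₃]

/-- Circular convolution of two tubes. -/
def circConv (a b : ZMod N₃ → ℝ) : ZMod N₃ → ℝ := fun n => ∑ l, a l * b (n - l)

/-- The t-product `A ∗ B`. -/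
def tprod (A : Tensor N₁ N₂ N₃) (B : Tensor N₂ N₄ N₃) : Tensor N₁ N₄ N₃ :=
  fun i j => ∑ k, circConv (A i k) (B k j)

/-- The tensor transpose: transpose each frontal slice and reverse the order of all frontal slices
but the first. -/
def ttranspose (A : Tensor N₁ N₂ N₃) : Tensor N₂ N₁ N₃ := fun j i k => A i j (-k)

/-- The identity tensor. -/
def tone (N N₃ : ℕ) : Tensor N N N₃ := fun i j k => if i = j ∧ k = 0 then 1 else 0

/-- Orthogonal tensors. -/
def IsOrthogonal (Q : Tensor N₁ N₁ N₃) : Prop :=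
  tprod (ttranspose Q) Q = tone N₁ N₃ ∧ tprod Q (ttranspose Q) = tone N₁ N₃

/-- f-diagonal tensors: every frontal slice is a (rectangular) diagonal matrix. -/
def IsFDiagonal (A : Tensor N₁ N₂ N₃) : Prop :=
  ∀ (i : Fin N₁) (j : Fin N₂), (i : ℕ) ≠ j → A i j = 0

/-- The `i`-th diagonal tube of a tensor. -/
def diagTube (A : Tensor N₁ N₂ N₃) (i : Fin (min N₁ N₂)) : ZMod N₃ → ℝ :=
  A (Fin.castLE (min_le_left _ _) i) (Fin.castLE (min_le_right _ _) i)

/-- `T = U ∗ Θ ∗ Vᵀ` is a t-SVD: `U`, `V` are orthogonal, `Θ` is f-diagonal, and the Frobenius norms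
of the diagonal tubes of `Θ` are in decreasing order. -/
structure IsTSVD (T : Tensor N₁ N₂ N₃) (U : Tensor N₁ N₁ N₃) (Θ : Tensor N₁ N₂ N₃)
    (V : Tensor N₂ N₂ N₃) : Prop where
  left_orthogonal : IsOrthogonal U
  right_orthogonal : IsOrthogonal V
  fDiagonal : IsFDiagonal Θ
  decreasing : ∀ i i' : Fin (min N₁ N₂), i ≤ i' →
    ∑ k, diagTube Θ i' k ^ 2 ≤ ∑ k, diagTube Θ i k ^ 2
  eq_tprod : T = tprod (tprod U Θ) (ttranspose V)

open Classical in
/-- The number of non-zero diagonal tubes of `Θ`; this is the tubal-rank of `T` when `Θ` is the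
middle factor of a t-SVD of `T`. -/
noncomputable def numNonzeroTubes (Θ : Tensor N₁ N₂ N₃) : ℕ :=
  (Finset.univ.filter fun i => diagTube Θ i ≠ 0).card

/-- The (unnormalised) discrete Fourier transform along the third mode. -/
noncomputable def fft (A : Tensor N₁ N₂ N₃) (i : Fin N₁) (j : Fin N₂) : ZMod N₃ → ℂ :=
  ZMod.dft fun l => (A i j l : ℂ)

/-- The coherence `μ(U) = (N₁/r) max_{i,k} ‖fft(Uᵀ)(:,:,k) eᵢ‖²` of the first `r` lateral slices
of `U`. -/
noncomputable def coherence (U : Tensor N₁ N₁ N₃) (r : ℕ) : ℝ :=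
  (N₁ / r : ℝ) * ⨆ p : Fin N₁ × ZMod N₃,
    ∑ c ∈ Finset.univ.filter (fun c : Fin N₁ => (c : ℕ) < r), ‖fft (ttranspose U) c p.1 p.2‖ ^ 2

end Tensor

/-! Lateral slices, t-spans and projections -/

namespace AdaptiveSampling

open Tensor

/-- `n × 1 × N₃` tensors; the norm is the Frobenius norm. -/
abbrev Slice (n N₃ : ℕ) : Type := EuclideanSpace ℝ (Fin n × ZMod N₃)

variable {N₁ N₂ N₃ m : ℕ} [NeZero N₃]

/-- The lateral slice `T(:,j,:)`. -/
noncomputable def lateral (T : Tensor N₁ N₂ N₃) (j : Fin N₂) : Slice N₁ N₃ :=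
  WithLp.toLp 2 fun p => T p.1 j p.2

/-- The t-product `x ∗ c` of a lateral slice with a tube. -/
noncomputable def sliceMul (x : Slice N₁ N₃) (c : ZMod N₃ → ℝ) : Slice N₁ N₃ :=
  WithLp.toLp 2 fun p => circConv (fun l => x (p.1, l)) c p.2

/-- The t-span of a set of lateral slices: all their t-linear combinations `∑ xⱼ ∗ cⱼ`. -/
noncomputable def tSpan (A : Set (Slice N₁ N₃)) : Submodule ℝ (Slice N₁ N₃) :=
  Submodule.span ℝ {y | ∃ x ∈ A, ∃ c : ZMod N₃ → ℝ, y = sliceMul x c}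

/-- Restriction of a lateral slice to the rows `ω 0, ω 1, …` (in this order). -/
noncomputable def restrictRows (ω : Fin m → Fin N₁) : Slice N₁ N₃ →ₗ[ℝ] Slice m N₃ where
  toFun x := WithLp.toLp 2 fun p => x (ω p.1, p.2)
  map_add' _ _ := rfl
  map_smul' _ _ := rfl

/-- `E(:,j,:)` for `E = P_{K⊥}(T)`, where `K` is a tensor-column subspace. -/
noncomputable def residual (T : Tensor N₁ N₂ N₃) (K : Submodule ℝ (Slice N₁ N₃)) (j : Fin N₂) :
    Slice N₁ N₃ :=
  Kᗮ.starProjection (lateral T j)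

/-- The squared Frobenius norm of `E = P_{K⊥}(T)`. -/
noncomputable def residualSq (T : Tensor N₁ N₂ N₃) (K : Submodule ℝ (Slice N₁ N₃)) : ℝ :=
  ∑ j, ‖residual T K j‖ ^ 2

/-- The true sampling probability `‖E(:,j,:)‖² / ‖E‖²`. -/
noncomputable def trueProb (T : Tensor N₁ N₂ N₃) (K : Submodule ℝ (Slice N₁ N₃)) (j : Fin N₂) : ℝ :=
  ‖residual T K j‖ ^ 2 / residualSq T K

/-- The residual energy seen on the sampled rows `ω` of column `j`: the squared distance of
`T(Ω_j,j,:)` from the tensor-column subspace `K_{Ω_j}`, the restriction of `K` to those rows. -/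
noncomputable def sampledSq (T : Tensor N₁ N₂ N₃) (K : Submodule ℝ (Slice N₁ N₃))
    (ω : Fin m → Fin N₁) (j : Fin N₂) : ℝ :=
  ‖(K.map (restrictRows ω))ᗮ.starProjection (restrictRows ω (lateral T j))‖ ^ 2

/-- The estimated sampling probability `p̂_j`, from the first-pass samples `Ω`. -/
noncomputable def estProb (T : Tensor N₁ N₂ N₃) (Ω : Fin N₂ → Fin m → Fin N₁)
    (K : Submodule ℝ (Slice N₁ N₃)) (j : Fin N₂) : ℝ :=
  sampledSq T K (Ω j) j / ∑ j', sampledSq T K (Ω j') j'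

theorem sampledSq_nonneg (T : Tensor N₁ N₂ N₃) (K : Submodule ℝ (Slice N₁ N₃))
    (ω : Fin m → Fin N₁) (j : Fin N₂) : 0 ≤ sampledSq T K ω j := sq_nonneg _

theorem estProb_nonneg (T : Tensor N₁ N₂ N₃) (Ω : Fin N₂ → Fin m → Fin N₁)
    (K : Submodule ℝ (Slice N₁ N₃)) (j : Fin N₂) : 0 ≤ estProb T Ω K j :=
  div_nonneg (sampledSq_nonneg _ _ _ _) (Finset.sum_nonneg fun _ _ => sampledSq_nonneg _ _ _ _)

theorem sum_estProb (T : Tensor N₁ N₂ N₃) (Ω : Fin N₂ → Fin m → Fin N₁)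
    (K : Submodule ℝ (Slice N₁ N₃)) (h : ∑ j, sampledSq T K (Ω j) j ≠ 0) :
    ∑ j, ENNReal.ofReal (estProb T Ω K j) = 1 := by
  rw [← ENNReal.ofReal_sum_of_nonneg fun j _ => estProb_nonneg T Ω K j]
  simp only [estProb]
  rw [← Finset.sum_div, div_self h, ENNReal.ofReal_one]

theorem sum_prod_estProb (s : ℕ) (T : Tensor N₁ N₂ N₃) (Ω : Fin N₂ → Fin m → Fin N₁)
    (K : Submodule ℝ (Slice N₁ N₃)) (h : ∑ j, sampledSq T K (Ω j) j ≠ 0) :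
    ∑ d : Fin s → Fin N₂, ∏ i, ENNReal.ofReal (estProb T Ω K (d i)) = 1 := by
  have := Finset.prod_univ_sum (fun _ : Fin s => (Finset.univ : Finset (Fin N₂)))
    (fun _ j => ENNReal.ofReal (estProb T Ω K j))
  rw [Fintype.piFinset_univ] at this
  rw [← this]
  simp [sum_estProb T Ω K h]

/-! The two-pass sampling algorithm -/

/-- The tensor-column subspace `Û` after the rounds in which the sets of columns listed in `h`
(most recent round first) were selected: in each round the selected columns are projected onto
`Û⊥`, normalised, and the result is concatenated to `Û`. -/
noncomputable def estSubspace (T : Tensor N₁ N₂ N₃) :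
    List (Finset (Fin N₂)) → Submodule ℝ (Slice N₁ N₃)
  | [] => ⊥
  | P :: h => estSubspace T h ⊔ tSpan {x | ∃ j ∈ P,
      x = (√(∑ j' ∈ P, ‖residual T (estSubspace T h) j'‖ ^ 2))⁻¹ • residual T (estSubspace T h) j}

open Classical in
/-- The law of the set of columns selected in one round: `s` independent draws from `p̂`. (Columns
selected in earlier rounds lie in `K`, so they have `p̂_j = 0` and are not drawn again.) If
`p̂` is not defined since its denominator is zero, nothing is selected. -/
noncomputable def roundLaw (T : Tensor N₁ N₂ N₃) (Ω : Fin N₂ → Fin m → Fin N₁) (s : ℕ)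
    (K : Submodule ℝ (Slice N₁ N₃)) : PMF (Finset (Fin N₂)) :=
  if h : ∑ j, sampledSq T K (Ω j) j ≠ 0 then
    (PMF.ofFintype (fun d : Fin s → Fin N₂ => ∏ i, ENNReal.ofReal (estProb T Ω K (d i)))
      (sum_prod_estProb s T Ω K h)).map fun d => Finset.univ.image d
  else PMF.pure ∅

/-- The law of the list (most recent round first) of the sets of columns selected in the first `l`
rounds of the second pass, given the first-pass samples `Ω`. -/
noncomputable def secondPassLaw (T : Tensor N₁ N₂ N₃) (Ω : Fin N₂ → Fin m → Fin N₁) (s : ℕ) :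
    ℕ → PMF (List (Finset (Fin N₂)))
  | 0 => PMF.pure []
  | l + 1 => (secondPassLaw T Ω s l).bind fun h =>
      (roundLaw T Ω s (estSubspace T h)).map fun P => P :: h

/-- The joint law of both passes. First pass: in each column, `m` rows are drawn
independently and uniformly. Second pass: `L` rounds with `s` draws each. -/
noncomputable def twoPassLaw [NeZero N₁] (T : Tensor N₁ N₂ N₃) (m s L : ℕ) :
    PMF ((Fin N₂ → Fin m → Fin N₁) × List (Finset (Fin N₂))) :=
  (PMF.uniformOfFintype (Fin N₂ → Fin m → Fin N₁)).bind fun Ω =>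
    (secondPassLaw T Ω s L).map fun h => (Ω, h)

/-- The joint law of both passes for the sampling budget `M`, the allocation ratio `δ` and `L`
rounds: `δM/N₂` rows of each column in the first pass, and `(1-δ)M/(N₂L)` draws of a column in each
round of the second pass, both rounded down. -/
noncomputable def algorithmLaw [NeZero N₁] (T : Tensor N₁ N₂ N₃) (M δ : ℝ) (L : ℕ) :
    PMF ((Fin N₂ → Fin ⌊δ * M / N₂⌋₊ → Fin N₁) × List (Finset (Fin N₂))) :=
  twoPassLaw T ⌊δ * M / N₂⌋₊ ⌊(1 - δ) * M / (N₂ * L)⌋₊ L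

/-- The required sampling budget. -/
noncomputable def budget (C : ℝ) (N₁ N₂ N₃ r : ℕ) (μ₀ ρ ε : ℝ) : ℝ :=
  C * r * N₂ * (μ₀ * Real.log (N₂ / ρ) * Real.log (r * N₂ / ρ) +
    (⌈Real.log ((N₁ : ℝ) * N₂ * N₃)⌉ : ℝ) ^ 2 / (ρ * ε))

end AdaptiveSampling

/-! In each Fourier slice the columns of `T` lie in a space of dimension at most r, and unit vectors
of that space have squared entries at most β = μ₀r/N₁. All subspaces built by the algorithm stay
inside these spaces and are closed under t-multiples.

Fix such a subspace K and let y be the residual of column j. The sampled energy is that of y on the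
sampled rows, minimised over perturbations y + x with x ∈ K. The unperturbed y gives the upper bound
by a Chernoff estimate (`pr_lt_sum_le`). For the lower bound, every slice z of y + x satisfies ⟨y,
z⟩ = ‖y‖², and all such z must be treated at once (`pr_exists_energy_lt_le`). Two estimates are
combined. A Kaczmarz iteration shows that every z is seen with a crude constant (`pr_energy_lt_le`).
A Cauchy–Schwarz bound with a regularising multiple of ‖z‖² moves all randomness to the fixed vector
y; independent groups of samples make its failure probability exponentially small (`pr_groups_le`),
and the crude bound pays for the regularisation. Logarithmically many groups, each of size
logarithmic times μ₀r, explain the squared logarithm. Slices that fail are handled by Markov's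
inequality on their share of the energy, not by a union bound, so N₃ does not enter
(`pr_not_sampledSq_mem_le`).

In the second pass K depends on the samples of column j. A failure at j can only occur while column
j is not yet captured, hence along a history that never selected j. Such a history is at least as
likely when the weight of j is set to zero (`drawLaw_le_drawLaw_update`), and that modified process
is independent of the samples of j. It suffices to inspect histories that have just captured a new
column; their expected number is at most N₂ + 1, whatever L is (`sum_toOuterMeasure_isNew_le`). With
failure probability 3(ρ/N₂)² for one column and one K, the total is at most N₂(N₂ + 1) · 3(ρ/N₂)² ≤
6ρ. If all columns are accurate within the factors 1/2 and 5/4, the quotients are accurate within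
2/5 and 5/2. -/

/-! Averages and probabilities over finite types -/

namespace FiniteProb

open Finset
open scoped BigOperators

open Classical in
/-- The probability of `p` under the uniform distribution on a finite type. -/
noncomputable def pr {α : Type*} [Fintype α] (p : α → Prop) : ℝ := 𝔼 a, if p a then (1 : ℝ) else 0

section

variable {α β : Type*} [Fintype α] [Fintype β]

theorem expect_mono {f g : α → ℝ} (h : ∀ a, f a ≤ g a) : 𝔼 a, f a ≤ 𝔼 a, g a :=
  Finset.expect_le_expect fun a _ => h a

theorem pr_mono {p q : α → Prop} (h : ∀ a, p a → q a) : pr p ≤ pr q := by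
  classical
  refine expect_mono fun a => ?_
  by_cases hp : p a
  · simp [hp, h a hp]
  · simp only [hp, if_false]; split_ifs <;> norm_num

theorem pr_nonneg (p : α → Prop) : 0 ≤ pr p :=
  Finset.expect_nonneg fun a _ => by split_ifs <;> norm_num

theorem pr_or_le (p q : α → Prop) : pr (fun a => p a ∨ q a) ≤ pr p + pr q := by
  classical
  rw [pr, pr, pr, ← expect_add_distrib]
  refine expect_mono fun a => ?_
  by_cases hp : p a <;> by_cases hq : q a <;> simp [hp, hq]

/-- Markov's inequality. -/
theorem mul_pr_le_expect {f : α → ℝ} (hf : ∀ a, 0 ≤ f a) (c : ℝ) :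
    c * pr (fun a => c ≤ f a) ≤ 𝔼 a, f a := by
  classical
  rw [pr, mul_expect]
  refine expect_mono fun a => ?_
  split_ifs with h
  · simpa using h
  · simpa using hf a

theorem expect_prod_type (f : α × β → ℝ) : 𝔼 x, f x = 𝔼 a, 𝔼 b, f (a, b) := by
  rw [← univ_product_univ, expect_product]

theorem expect_cons {m : ℕ} (f : (Fin (m + 1) → α) → ℝ) :
    𝔼 ω, f ω = 𝔼 a, 𝔼 ω : Fin m → α, f (Fin.cons a ω) := by
  rw [← expect_prod_type (fun x : α × (Fin m → α) => f (Fin.cons x.1 x.2))]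
  exact (Fintype.expect_equiv (Fin.consEquiv fun _ => α) _ _ fun x => rfl).symm

theorem expect_prod_pi {m : ℕ} (f : α → ℝ) :
    𝔼 ω : Fin m → α, ∏ t, f (ω t) = (𝔼 a, f a) ^ m := by
  rw [expect_pow, Fintype.piFinset_univ]

/-- Only the coordinates that a function depends on matter for its average. -/
theorem expect_comp_embedding [Nonempty α] {κ μ : Type*} [Fintype κ] [Fintype μ]
    [DecidableEq κ] [DecidableEq μ]
    (e : κ ↪ μ) (f : (κ → α) → ℝ) :
    𝔼 ω : μ → α, f (ω ∘ e) = 𝔼 ω : κ → α, f ω := by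
  classical
  let E : μ ≃ κ ⊕ ((Set.range e)ᶜ : Set μ) :=
    (Equiv.Set.sumCompl (Set.range e)).symm.trans
      (Equiv.sumCongr (Equiv.ofInjective e e.injective).symm (Equiv.refl _))
  have hE : ∀ k, E.symm (Sum.inl k) = e k := fun k => by simp [E]
  let F : (μ → α) ≃ (κ → α) × (((Set.range e)ᶜ : Set μ) → α) :=
    (Equiv.arrowCongr E (Equiv.refl α)).trans (Equiv.sumArrowEquivProdArrow _ _ _)
  have hF : ∀ ω, (F ω).1 = ω ∘ e := fun ω => by
    funext k
    simp [F, Equiv.sumArrowEquivProdArrow, hE]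
  rw [Fintype.expect_equiv F (fun ω => f (ω ∘ e)) (fun x => f x.1) fun ω => by rw [hF],
    expect_prod_type]
  simp

end

end FiniteProb

/-! Row sampling of a Parseval frame -/

namespace FrameSampling

open Finset FiniteProb
open scoped BigOperators InnerProductSpace

variable {ι : Type*} {H : Type*} [NormedAddCommGroup H] [InnerProductSpace ℂ H]

/-- One relaxed Kaczmarz step. -/
noncomputable def kaczStep (s : ℝ) (u : H) : H →ₗ[ℂ] H :=
  LinearMap.id - (s : ℂ) • ((innerSL ℂ u).toLinearMap.smulRight u)

theorem kaczStep_apply (s : ℝ) (u w : H) : kaczStep s u w = w - ((s : ℂ) * ⟪u, w⟫_ℂ) • u := by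
  simp [kaczStep, mul_smul]

/-- The composition of the Kaczmarz steps along a sample. -/
noncomputable def kacz (s : ℝ) (a : ι → H) : {m : ℕ} → (Fin m → ι) → H →ₗ[ℂ] H
  | 0, _ => LinearMap.id
  | _ + 1, ω => kacz s a (Fin.tail ω) ∘ₗ kaczStep s (a (ω 0))

/-- The energy of `z` seen by a sample of the frame. -/
noncomputable def energy (a : ι → H) {κ : Type*} [Fintype κ] (ω : κ → ι) (z : H) : ℝ :=
  ∑ t, ‖⟪a (ω t), z⟫_ℂ‖ ^ 2

theorem energy_nonneg (a : ι → H) {κ : Type*} [Fintype κ] (ω : κ → ι) (z : H) :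
    0 ≤ energy a ω z := sum_nonneg fun _ _ => sq_nonneg _

/-- The square expands with −2s|⟨u, w⟩|² + s²‖u‖²|⟨u, w⟩|², and s‖u‖² ≤ 1 absorbs half of the gain.
-/
theorem norm_kaczStep_sq_le {s β : ℝ} (hs : 0 ≤ s) (hsβ : s * β ≤ 1) {u : H} (hu : ‖u‖ ^ 2 ≤ β)
    (w : H) : ‖kaczStep s u w‖ ^ 2 ≤ ‖w‖ ^ 2 - s * ‖⟪u, w⟫_ℂ‖ ^ 2 := by
  rw [kaczStep_apply, @norm_sub_sq ℂ, norm_smul, inner_smul_right, mul_assoc,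
    ← inner_conj_symm w u]
  have h1 : RCLike.re ((s : ℂ) * (⟪u, w⟫_ℂ * (starRingEnd ℂ) ⟪u, w⟫_ℂ)) = s * ‖⟪u, w⟫_ℂ‖ ^ 2 := by
    rw [Complex.mul_conj, Complex.normSq_eq_norm_sq]
    norm_cast
  rw [h1, norm_mul, Complex.norm_real, Real.norm_eq_abs, abs_of_nonneg hs]
  have h2 : s * ‖u‖ ^ 2 ≤ 1 := (mul_le_mul_of_nonneg_left hu hs).trans hsβ
  have h3 : 0 ≤ s * ‖⟪u, w⟫_ℂ‖ ^ 2 := by positivity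
  nlinarith

section Parseval

variable [Fintype ι] {a : ι → H} (ha : ∀ y, ∑ i, ⟪a i, y⟫_ℂ • a i = y)
include ha

theorem sum_norm_inner_sq (y : H) : ∑ i, ‖⟪a i, y⟫_ℂ‖ ^ 2 = ‖y‖ ^ 2 := by
  have h : ⟪y, ∑ i, ⟪a i, y⟫_ℂ • a i⟫_ℂ = ((‖y‖ ^ 2 : ℝ) : ℂ) := by
    rw [ha y, inner_self_eq_norm_sq_to_K]; norm_cast
  rw [inner_sum] at h
  simp only [inner_smul_right] at h
  rw [← Complex.ofReal_inj, ← h]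
  push_cast
  refine sum_congr rfl fun i _ => ?_
  rw [← inner_conj_symm y (a i), Complex.mul_conj, Complex.normSq_eq_norm_sq]
  push_cast; rfl

end Parseval

theorem norm_kacz_sq_le {s β : ℝ} (hs : 0 ≤ s) (hsβ : s * β ≤ 1) {a : ι → H}
    (hb : ∀ i, ‖a i‖ ^ 2 ≤ β) : ∀ {m : ℕ} (ω : Fin m → ι) (v : H), ‖kacz s a ω v‖ ^ 2 ≤ ‖v‖ ^ 2
  | 0, _, v => le_rfl
  | m + 1, ω, v => by
    refine (norm_kacz_sq_le hs hsβ hb (Fin.tail ω) _).trans ?_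
    have := norm_kaczStep_sq_le hs hsβ (hb (ω 0)) v
    have h3 : 0 ≤ s * ‖⟪a (ω 0), v⟫_ℂ‖ ^ 2 := by positivity
    linarith

/-- The displacement is Σ s⟨aₜ, vₜ⟩aₜ along the trajectory vₜ, and s Σ|⟨aₜ, vₜ⟩|² is at most the
telescoping loss of squared norm. Cauchy–Schwarz against the coefficients ⟨aₜ, z⟩ gives the bound;
the induction performs it one step at a time. -/
theorem norm_inner_sub_kacz_sq_le {s β : ℝ} (hs : 0 ≤ s) (hsβ : s * β ≤ 1) {a : ι → H}
    (hb : ∀ i, ‖a i‖ ^ 2 ≤ β) (z : H) : ∀ {m : ℕ} (ω : Fin m → ι) (v : H),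
    ‖⟪z, v - kacz s a ω v⟫_ℂ‖ ^ 2 ≤ s * energy a ω z * (‖v‖ ^ 2 - ‖kacz s a ω v‖ ^ 2)
  | 0, _, v => by simp [kacz, energy]
  | m + 1, ω, v => by
    set v₁ := kaczStep s (a (ω 0)) v with hv₁
    have ih := norm_inner_sub_kacz_sq_le hs hsβ hb z (Fin.tail ω) v₁
    have hk : kacz s a ω v = kacz s a (Fin.tail ω) v₁ := rfl
    set w := kacz s a (Fin.tail ω) v₁ with hw
    have hD : 0 ≤ ‖v₁‖ ^ 2 - ‖w‖ ^ 2 := sub_nonneg.2 (norm_kacz_sq_le hs hsβ hb _ _)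
    have hstep := norm_kaczStep_sq_le hs hsβ (hb (ω 0)) v
    rw [← hv₁] at hstep
    have hE : energy a ω z = ‖⟪a (ω 0), z⟫_ℂ‖ ^ 2 + energy a (Fin.tail ω) z := by
      simp [energy, Fin.sum_univ_succ, Fin.tail]
    have hQ := energy_nonneg a (Fin.tail ω) z
    set Q := energy a (Fin.tail ω) z
    set g := ‖⟪a (ω 0), z⟫_ℂ‖ with hg
    set α := ‖⟪a (ω 0), v⟫_ℂ‖ with hα
    have hg0 : 0 ≤ g := norm_nonneg _
    have hα0 : 0 ≤ α := norm_nonneg _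
    rw [hk, hE]
    have hsplit : ‖⟪z, v - w⟫_ℂ‖ ≤ s * g * α + ‖⟪z, v₁ - w⟫_ℂ‖ := by
      have : v - w = ((s : ℂ) * ⟪a (ω 0), v⟫_ℂ) • a (ω 0) + (v₁ - w) := by
        rw [hv₁, kaczStep_apply]; abel
      rw [this, inner_add_right, inner_smul_right]
      refine (norm_add_le _ _).trans ?_
      rw [norm_mul, norm_mul, Complex.norm_real, Real.norm_eq_abs, abs_of_nonneg hs,
        norm_inner_symm z (a (ω 0))]
      apply le_of_eq; ring
    set X := ‖⟪z, v₁ - w⟫_ℂ‖ with hX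
    have hX0 : 0 ≤ X := norm_nonneg _
    have hcs : (s * g * α + X) ^ 2 ≤ s * (g ^ 2 + Q) * (s * α ^ 2 + (‖v₁‖ ^ 2 - ‖w‖ ^ 2)) := by
      set D := ‖v₁‖ ^ 2 - ‖w‖ ^ 2
      rcases eq_or_lt_of_le hs with rfl | hs
      · simp only [zero_mul] at ih ⊢; nlinarith
      -- AM–GM for the cross term, since X² ≤ sQD by induction.
      have h2 : 2 * (g * α) * X ≤ g ^ 2 * D + s * Q * α ^ 2 := by
        have h4 : (2 * (g * α) * X) ^ 2 ≤ (g ^ 2 * D + s * Q * α ^ 2) ^ 2 := by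
          have : (g * α) ^ 2 * X ^ 2 ≤ (g * α) ^ 2 * (s * Q * D) :=
            mul_le_mul_of_nonneg_left ih (sq_nonneg _)
          nlinarith [sq_nonneg (g ^ 2 * D - s * Q * α ^ 2)]
        exact abs_le_of_sq_le_sq' h4 (by positivity) |>.2
      nlinarith
    calc ‖⟪z, v - w⟫_ℂ‖ ^ 2 ≤ (s * g * α + X) ^ 2 := by gcongr
      _ ≤ _ := hcs
      _ ≤ _ := by
        refine mul_le_mul_of_nonneg_left (by linarith) (by positivity)

/-- A vector that the iteration halves has moved by at least ‖v‖²/2 in its own direction, which is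
impossible unless the sample sees it: take z = v in `norm_inner_sub_kacz_sq_le`. -/
theorem energy_ge_of_norm_kacz_le {s β : ℝ} (hs : 0 < s) (hsβ : s * β ≤ 1) {a : ι → H}
    (hb : ∀ i, ‖a i‖ ^ 2 ≤ β) {m : ℕ} (ω : Fin m → ι) (v : H)
    (h : ‖kacz s a ω v‖ ≤ 2⁻¹ * ‖v‖) : ‖v‖ ^ 2 ≤ 4 * s * energy a ω v := by
  rcases eq_or_lt_of_le (norm_nonneg v) with h0 | h0
  · rw [← h0, zero_pow two_ne_zero]
    exact mul_nonneg (by positivity) (energy_nonneg a ω v)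
  have h1 := norm_inner_sub_kacz_sq_le hs.le hsβ hb v ω v
  have h2 : 2⁻¹ * ‖v‖ ^ 2 ≤ ‖⟪v, v - kacz s a ω v⟫_ℂ‖ := by
    rw [inner_sub_right]
    have h3 := norm_sub_norm_le (⟪v, v⟫_ℂ) (⟪v, kacz s a ω v⟫_ℂ)
    have h4 : ‖⟪v, kacz s a ω v⟫_ℂ‖ ≤ ‖v‖ * (2⁻¹ * ‖v‖) :=
      (norm_inner_le_norm _ _).trans (by gcongr)
    have h5 : ‖⟪v, v⟫_ℂ‖ = ‖v‖ ^ 2 := by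
      rw [inner_self_eq_norm_sq_to_K]; simp
    nlinarith
  have h6 : (2⁻¹ * ‖v‖ ^ 2) ^ 2 ≤ s * energy a ω v * ‖v‖ ^ 2 := by
    refine (pow_le_pow_left₀ (by positivity) h2 2).trans (h1.trans ?_)
    refine mul_le_mul_of_nonneg_left ?_ (mul_nonneg hs.le (energy_nonneg _ _ _))
    nlinarith [sq_nonneg ‖kacz s a ω v‖]
  have h7 : 0 < ‖v‖ ^ 2 := by positivity
  nlinarith

section Random

variable [Fintype ι] [Nonempty ι] {a : ι → H}

/-- By the Parseval identity the average loss s|⟨aᵢ, v⟩|² in one step is exactly s‖v‖² divided by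
the number of frame vectors. -/
theorem expect_norm_kacz_sq_le (ha : ∀ y, ∑ i, ⟪a i, y⟫_ℂ • a i = y) {s β : ℝ} (hs : 0 ≤ s)
    (hsβ : s * β ≤ 1) (hb : ∀ i, ‖a i‖ ^ 2 ≤ β) (hsN : s ≤ Fintype.card ι) :
    ∀ {m : ℕ} (v : H), 𝔼 ω : Fin m → ι, ‖kacz s a ω v‖ ^ 2 ≤ (1 - s / Fintype.card ι) ^ m * ‖v‖ ^ 2
  | 0, v => by simp [kacz]
  | m + 1, v => by
    have hN : (0 : ℝ) < Fintype.card ι := by exact_mod_cast Fintype.card_pos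
    have h0 : 0 ≤ 1 - s / Fintype.card ι := sub_nonneg.2 ((div_le_one hN).2 hsN)
    rw [expect_cons]
    calc 𝔼 i, 𝔼 ω : Fin m → ι, ‖kacz s a (Fin.cons i ω : Fin (m + 1) → ι) v‖ ^ 2
        = 𝔼 i, 𝔼 ω : Fin m → ι, ‖kacz s a ω (kaczStep s (a i) v)‖ ^ 2 := by
          simp [kacz]
      _ ≤ 𝔼 i, (1 - s / Fintype.card ι) ^ m * (‖v‖ ^ 2 - s * ‖⟪a i, v⟫_ℂ‖ ^ 2) := by
          refine expect_mono fun i => (expect_norm_kacz_sq_le ha hs hsβ hb hsN _).trans ?_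
          exact mul_le_mul_of_nonneg_left (norm_kaczStep_sq_le hs hsβ (hb i) v) (pow_nonneg h0 m)
      _ = (1 - s / Fintype.card ι) ^ (m + 1) * ‖v‖ ^ 2 := by
          rw [← mul_expect, expect_sub_distrib, Fintype.expect_const, ← mul_expect,
            Fintype.expect_eq_sum_div_card, sum_norm_inner_sq ha]
          ring

/-- With high probability, a sample of the frame sees a fair share of every vector. -/
theorem pr_energy_lt_le [FiniteDimensional ℂ H] (ha : ∀ y, ∑ i, ⟪a i, y⟫_ℂ • a i = y) {s β : ℝ}
    (hs : 0 < s) (hsβ : s * β ≤ 1) (hb : ∀ i, ‖a i‖ ^ 2 ≤ β) (hsN : s ≤ Fintype.card ι) (m : ℕ) :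
    pr (fun ω : Fin m → ι => ∃ v : H, 4 * s * energy a ω v < ‖v‖ ^ 2) ≤
      4 * (Module.finrank ℂ H * (1 - s / Fintype.card ι) ^ m) := by
  let b := stdOrthonormalBasis ℂ H
  have h1 : 𝔼 ω : Fin m → ι, ∑ i, ‖kacz s a ω (b i)‖ ^ 2 ≤
      Module.finrank ℂ H * (1 - s / Fintype.card ι) ^ m := by
    rw [expect_sum_comm]
    calc _ ≤ ∑ _i : Fin (Module.finrank ℂ H), (1 - s / Fintype.card ι) ^ m := by
          refine sum_le_sum fun i _ => ?_
          simpa using expect_norm_kacz_sq_le ha hs.le hsβ hb hsN (m := m) (b i)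
      _ = _ := by simp
  have h2 := mul_pr_le_expect (f := fun ω : Fin m → ι => ∑ i, ‖kacz s a ω (b i)‖ ^ 2)
    (fun ω => sum_nonneg fun i _ => sq_nonneg _) 4⁻¹
  have h3 : pr (fun ω : Fin m → ι => ∃ v : H, 4 * s * energy a ω v < ‖v‖ ^ 2) ≤
      pr fun ω : Fin m → ι => (4⁻¹ : ℝ) ≤ ∑ i, ‖kacz s a ω (b i)‖ ^ 2 := by
    refine pr_mono fun ω => ?_
    rintro ⟨v, hv⟩
    by_contra hlt
    push Not at hlt
    refine absurd (energy_ge_of_norm_kacz_le hs hsβ hb ω v ?_) (not_le.2 hv)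
    -- The operator norm is at most the Hilbert–Schmidt norm, whose square is now below 1/4. Only
    -- the latter has an expectation that is easy to bound.
    have h4 : ‖kacz s a ω v‖ ≤ ∑ i, ‖⟪b i, v⟫_ℂ‖ * ‖kacz s a ω (b i)‖ := by
      conv_lhs => rw [← b.sum_repr' v, map_sum]
      refine (norm_sum_le _ _).trans (le_of_eq (sum_congr rfl fun i _ => ?_))
      rw [map_smul, norm_smul]
    have h5 := sum_mul_sq_le_sq_mul_sq univ (fun i => ‖⟪b i, v⟫_ℂ‖) (fun i => ‖kacz s a ω (b i)‖)
    rw [b.sum_sq_norm_inner_right] at h5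
    refine abs_le_of_sq_le_sq' (b := 2⁻¹ * ‖v‖) ?_ (by positivity) |>.2
    calc ‖kacz s a ω v‖ ^ 2 ≤ _ := pow_le_pow_left₀ (norm_nonneg _) h4 2
      _ ≤ _ := h5
      _ ≤ ‖v‖ ^ 2 * 4⁻¹ := mul_le_mul_of_nonneg_left hlt.le (sq_nonneg _)
      _ = _ := by ring
  linarith

end Random

end FrameSampling

/-! ### Energies of all vectors with a prescribed projection to a line -/

namespace FrameSampling

open Finset FiniteProb
open scoped BigOperators InnerProductSpace

variable {ι : Type*} {H : Type*} [NormedAddCommGroup H] [InnerProductSpace ℂ H]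

/-- The sampled frame operator. -/
noncomputable def sampledFrame (a : ι → H) {m : ℕ} (ω : Fin m → ι) (y : H) : H :=
  ∑ t, ⟪a (ω t), y⟫_ℂ • a (ω t)

theorem norm_inner_sampledFrame_sq_le (a : ι → H) {m : ℕ} (ω : Fin m → ι) (y z : H) :
    ‖⟪z, sampledFrame a ω y⟫_ℂ‖ ^ 2 ≤ energy a ω z * energy a ω y := by
  have h1 : ‖⟪z, sampledFrame a ω y⟫_ℂ‖ ≤
      ∑ t, ‖⟪a (ω t), z⟫_ℂ‖ * ‖⟪a (ω t), y⟫_ℂ‖ := by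
    rw [sampledFrame, inner_sum]
    refine (norm_sum_le _ _).trans (le_of_eq (sum_congr rfl fun t _ => ?_))
    rw [inner_smul_right, norm_mul, norm_inner_symm z, mul_comm]
  exact (pow_le_pow_left₀ (norm_nonneg _) h1 2).trans (sum_mul_sq_le_sq_mul_sq _ _ _)

/-- The energy of `y` together with the scaled deviation of the sampled frame operator. -/
noncomputable def defect (a : ι → H) (c l : ℝ) (y : H) {m : ℕ} (ω : Fin m → ι) : ℝ :=
  energy a ω y + ‖sampledFrame a ω y - (c : ℂ) • y‖ ^ 2 / l

/-- With S the sampled frame operator, c‖y‖² = ⟨z, Sy⟩ − ⟨z, Sy − cy⟩; Cauchy–Schwarz applies to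
both terms and then to their sum. The point is that `defect` does not depend on z, so a single
random quantity controls all z. -/
theorem sq_le_mul_defect (a : ι → H) {c l : ℝ} (hc : 0 ≤ c) (hl : 0 < l) {m : ℕ} (ω : Fin m → ι)
    {y z : H} (h : ⟪y, z⟫_ℂ = ((‖y‖ ^ 2 : ℝ) : ℂ)) :
    (c * ‖y‖ ^ 2) ^ 2 ≤ (energy a ω z + l * ‖z‖ ^ 2) * defect a c l y ω := by
  set D := sampledFrame a ω y - (c : ℂ) • y with hD
  have hzy : ⟪z, y⟫_ℂ = ((‖y‖ ^ 2 : ℝ) : ℂ) := by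
    rw [← inner_conj_symm, h, Complex.conj_ofReal]
  have h1 : c * ‖y‖ ^ 2 ≤ ‖⟪z, sampledFrame a ω y⟫_ℂ‖ + ‖z‖ * ‖D‖ := by
    have h2 : ((c * ‖y‖ ^ 2 : ℝ) : ℂ) = ⟪z, sampledFrame a ω y⟫_ℂ - ⟪z, D⟫_ℂ := by
      rw [hD, inner_sub_right, inner_smul_right, hzy]; push_cast; ring
    calc c * ‖y‖ ^ 2 = ‖((c * ‖y‖ ^ 2 : ℝ) : ℂ)‖ := by
          rw [Complex.norm_real, Real.norm_eq_abs, abs_of_nonneg (by positivity)]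
      _ ≤ _ := by
          rw [h2]
          exact (norm_sub_le _ _).trans (by gcongr; exact norm_inner_le_norm _ _)
  have h3 := norm_inner_sampledFrame_sq_le a ω y z
  set X := ‖⟪z, sampledFrame a ω y⟫_ℂ‖
  have hX : 0 ≤ X := norm_nonneg _
  have hz := energy_nonneg a ω z
  have hy := energy_nonneg a ω y
  rw [defect, ← hD]
  set Ez := energy a ω z
  set Ey := energy a ω y
  have hp : 0 ≤ ‖z‖ := norm_nonneg _
  have hq : 0 ≤ ‖D‖ := norm_nonneg _
  set p := ‖z‖
  set q := ‖D‖
  have h4 : 2 * X * (p * q) ≤ Ez * (q ^ 2 / l) + l * p ^ 2 * Ey := by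
    have h5 : (2 * X * (p * q)) ^ 2 ≤ (Ez * (q ^ 2 / l) + l * p ^ 2 * Ey) ^ 2 := by
      have h6 : X ^ 2 * (p * q) ^ 2 ≤ Ez * Ey * (p * q) ^ 2 :=
        mul_le_mul_of_nonneg_right h3 (sq_nonneg _)
      have h7 : Ez * (q ^ 2 / l) * (l * p ^ 2 * Ey) = Ez * Ey * (p * q) ^ 2 := by
        field_simp
      nlinarith [sq_nonneg (Ez * (q ^ 2 / l) - l * p ^ 2 * Ey)]
    exact abs_le_of_sq_le_sq' h5 (by positivity) |>.2
  calc (c * ‖y‖ ^ 2) ^ 2 ≤ (X + p * q) ^ 2 := by gcongr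
    _ = X ^ 2 + 2 * X * (p * q) + (l * p ^ 2) * (q ^ 2 / l) := by field_simp; ring
    _ ≤ _ := by nlinarith

theorem expect_norm_sum_sq [Fintype ι] [Nonempty ι] (ξ : ι → H) (hξ : ∑ i, ξ i = 0) : ∀ m : ℕ,
    𝔼 ω : Fin m → ι, ‖∑ t, ξ (ω t)‖ ^ 2 = m * 𝔼 i, ‖ξ i‖ ^ 2
  | 0 => by simp
  | m + 1 => by
    rw [expect_cons]
    simp only [Fin.sum_univ_succ, Fin.cons_zero, Fin.cons_succ, @norm_add_sq ℂ]
    rw [expect_comm]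
    have h : ∀ S : H, 𝔼 i, (‖ξ i‖ ^ 2 + 2 * RCLike.re ⟪ξ i, S⟫_ℂ + ‖S‖ ^ 2) =
        𝔼 i, ‖ξ i‖ ^ 2 + ‖S‖ ^ 2 := fun S => by
      have h0 : 𝔼 i, RCLike.re ⟪ξ i, S⟫_ℂ = 0 := by
        rw [Fintype.expect_eq_sum_div_card, ← map_sum, ← sum_inner, hξ]; simp
      rw [expect_add_distrib, expect_add_distrib, ← mul_expect, h0]; simp
    simp only [h]
    rw [expect_add_distrib, expect_norm_sum_sq ξ hξ m, Fintype.expect_const]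
    push_cast; ring

section Random

variable [Fintype ι] [Nonempty ι] {a : ι → H} (ha : ∀ y, ∑ i, ⟪a i, y⟫_ℂ • a i = y)
include ha

theorem expect_energy (y : H) : ∀ m : ℕ,
    𝔼 ω : Fin m → ι, energy a ω y = m / Fintype.card ι * ‖y‖ ^ 2
  | 0 => by simp [energy]
  | m + 1 => by
    have h : ∀ i (ω : Fin m → ι), energy a (Fin.cons i ω : Fin (m + 1) → ι) y =
        ‖⟪a i, y⟫_ℂ‖ ^ 2 + energy a ω y := fun i ω => by simp [energy, Fin.sum_univ_succ]
    rw [expect_cons]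
    simp only [h, expect_add_distrib, expect_energy y m, Fintype.expect_const]
    rw [Fintype.expect_eq_sum_div_card, sum_norm_inner_sq ha]
    push_cast; ring

/-- The deviation of Sy from its mean is a sum of independent centred vectors, each of variance at
most β‖y‖²/N because ‖⟨aᵢ, y⟩aᵢ‖² ≤ β|⟨aᵢ, y⟩|². -/
theorem expect_defect_le {β l : ℝ} (hb : ∀ i, ‖a i‖ ^ 2 ≤ β) (hl : 0 < l) (m : ℕ) (y : H) :
    𝔼 ω : Fin m → ι, defect a (m / Fintype.card ι) l y ω ≤
      m / Fintype.card ι * (1 + β / l) * ‖y‖ ^ 2 := by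
  have hN : (0 : ℝ) < Fintype.card ι := by exact_mod_cast Fintype.card_pos
  set N : ℝ := (Fintype.card ι : ℝ) with hNdef
  let ξ : ι → H := fun i => ⟪a i, y⟫_ℂ • a i - ((N⁻¹ : ℝ) : ℂ) • y
  have hξ : ∑ i, ξ i = 0 := by
    simp only [ξ, sum_sub_distrib, ha y, sum_const, card_univ]
    rw [← Nat.cast_smul_eq_nsmul ℂ, smul_smul]
    have : ((Fintype.card ι : ℕ) : ℂ) * ((N⁻¹ : ℝ) : ℂ) = 1 := by
      rw [hNdef]; push_cast; field_simp
    rw [this, one_smul, sub_self]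
  have hvar : 𝔼 i, ‖ξ i‖ ^ 2 ≤ β / N * ‖y‖ ^ 2 := by
    rw [Fintype.expect_eq_sum_div_card, ← hNdef, div_mul_eq_mul_div, div_le_div_iff_of_pos_right hN]
    calc ∑ i, ‖ξ i‖ ^ 2
        = ∑ i, (‖⟪a i, y⟫_ℂ • a i‖ ^ 2 - N⁻¹ * (2 * ‖⟪a i, y⟫_ℂ‖ ^ 2) + N⁻¹ ^ 2 * ‖y‖ ^ 2) := by
          refine sum_congr rfl fun i _ => ?_
          simp only [ξ]
          rw [@norm_sub_sq ℂ, inner_smul_left, inner_smul_right, norm_smul (((N⁻¹ : ℝ) : ℂ)),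
            Complex.norm_real, Real.norm_eq_abs, abs_of_pos (inv_pos.2 hN), mul_pow]
          have : RCLike.re ((starRingEnd ℂ) ⟪a i, y⟫_ℂ * (((N⁻¹ : ℝ) : ℂ) * ⟪a i, y⟫_ℂ)) =
              N⁻¹ * ‖⟪a i, y⟫_ℂ‖ ^ 2 := by
            rw [mul_left_comm, mul_comm _ ⟪a i, y⟫_ℂ, Complex.mul_conj,
              Complex.normSq_eq_norm_sq]
            norm_cast
          rw [this]; ring
      _ = ∑ i, ‖⟪a i, y⟫_ℂ • a i‖ ^ 2 - N⁻¹ * ‖y‖ ^ 2 := by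
          rw [sum_add_distrib, sum_sub_distrib, ← mul_sum, ← mul_sum, sum_norm_inner_sq ha,
            sum_const, card_univ, nsmul_eq_mul, ← hNdef]
          field_simp; ring
      _ ≤ ∑ i, ‖⟪a i, y⟫_ℂ‖ ^ 2 * β := by
          have : 0 ≤ N⁻¹ * ‖y‖ ^ 2 := by positivity
          refine (sub_le_self _ this).trans (sum_le_sum fun i _ => ?_)
          rw [norm_smul, mul_pow]
          exact mul_le_mul_of_nonneg_left (hb i) (sq_nonneg _)
      _ = β * ‖y‖ ^ 2 := by rw [← sum_mul, sum_norm_inner_sq ha, mul_comm]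
  have hD : ∀ ω : Fin m → ι, sampledFrame a ω y - ((m / N : ℝ) : ℂ) • y = ∑ t, ξ (ω t) := by
    intro ω
    simp only [ξ, sum_sub_distrib, sampledFrame, sum_const, card_univ, Fintype.card_fin]
    rw [← Nat.cast_smul_eq_nsmul ℂ, smul_smul]
    congr 2
    push_cast; ring
  simp only [defect, expect_add_distrib, expect_energy ha, hD, ← expect_div,
    expect_norm_sum_sq ξ hξ]
  rw [← hNdef]
  have h5 : (m : ℝ) * 𝔼 i, ‖ξ i‖ ^ 2 ≤ m * (β / N * ‖y‖ ^ 2) := by gcongr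
  calc m / N * ‖y‖ ^ 2 + (m * 𝔼 i, ‖ξ i‖ ^ 2) / l
      ≤ m / N * ‖y‖ ^ 2 + (m * (β / N * ‖y‖ ^ 2)) / l := by gcongr
    _ = _ := by ring

/-- Independent groups of samples: with high probability, the regularised energies of all vectors
at distance at least `‖y‖` in the direction of `y` add up to almost the expected value. -/
theorem pr_groups_le {β : ℝ} (hβ : 0 < β) (hb : ∀ i, ‖a i‖ ^ 2 ≤ β) (G m : ℕ) (y : H) :
    pr (fun ω : Fin G → Fin m → ι => ∃ z, ⟪y, z⟫_ℂ = ((‖y‖ ^ 2 : ℝ) : ℂ) ∧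
      ∑ g, energy a (ω g) z + G * (20 * β) * ‖z‖ ^ 2 <
        19 / 21 * (G * m / Fintype.card ι) * ‖y‖ ^ 2) ≤ Real.exp (-(G / 20)) := by
  have hN : (0 : ℝ) < Fintype.card ι := by exact_mod_cast Fintype.card_pos
  have hl : (0 : ℝ) < 20 * β := by positivity
  rcases eq_or_lt_of_le (norm_nonneg y) with hy | hy
  · refine le_trans (le_of_eq ?_) (Real.exp_pos _).le
    rw [pr]
    refine Finset.expect_eq_zero fun ω _ => if_neg ?_
    rintro ⟨z, -, hz⟩
    rw [← hy] at hz
    have : 0 ≤ ∑ g, energy a (ω g) z := sum_nonneg fun g _ => energy_nonneg _ _ _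
    have : 0 ≤ G * (20 * β) * ‖z‖ ^ 2 := by positivity
    simp at hz; linarith
  rcases Nat.eq_zero_or_pos m with rfl | hm
  · refine le_trans (le_of_eq ?_) (Real.exp_pos _).le
    rw [pr]
    refine Finset.expect_eq_zero fun ω _ => if_neg ?_
    rintro ⟨z, -, hz⟩
    have : 0 ≤ ∑ g, energy a (ω g) z := sum_nonneg fun g _ => energy_nonneg _ _ _
    have : 0 ≤ G * (20 * β) * ‖z‖ ^ 2 := by positivity
    simp at hz; linarith
  have hm' : (0 : ℝ) < m := by exact_mod_cast hm
  set N : ℝ := (Fintype.card ι : ℝ) with hNdef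
  -- This normalises the defect to mean at most 1; 21/20 is 1 + β/l for l = 20β.
  set c : ℝ := (m / N * (21 / 20) * ‖y‖ ^ 2)⁻¹ with hc
  have hc0 : 0 < c := by positivity
  let Y : (Fin m → ι) → ℝ := fun ω => c * defect a (m / N) (20 * β) y ω
  have hY0 : ∀ ω, 0 ≤ Y ω := fun ω =>
    mul_nonneg hc0.le (add_nonneg (energy_nonneg _ _ _) (by positivity))
  have hEY : 𝔼 ω, Y ω ≤ 1 := by
    simp only [Y, ← mul_expect]
    have := expect_defect_le ha hb hl m y
    rw [← hNdef] at this
    calc _ ≤ c * (m / N * (1 + β / (20 * β)) * ‖y‖ ^ 2) := by gcongr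
      _ = 1 := by
        have : 1 + β / (20 * β) = 21 / 20 := by field_simp; norm_num
        rw [this, hc, inv_mul_cancel₀ (by positivity)]
  -- Bounding the product over independent groups, rather than a sum, yields an exponential tail
  -- from first moments alone.
  have hprod : 𝔼 ω : Fin G → Fin m → ι, ∏ g, Y (ω g) ≤ 1 := by
    rw [expect_prod_pi]
    exact pow_le_one₀ (expect_nonneg fun ω _ => hY0 ω) hEY
  have hmarkov := mul_pr_le_expect (f := fun ω : Fin G → Fin m → ι => ∏ g, Y (ω g))
    (fun ω => prod_nonneg fun g _ => hY0 _) (Real.exp (G / 20))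
  have hpr : pr (fun ω : Fin G → Fin m → ι => Real.exp (G / 20) ≤ ∏ g, Y (ω g)) ≤
      Real.exp (-(G / 20)) := by
    rw [Real.exp_neg, ← one_div, le_div_iff₀ (Real.exp_pos _), mul_comm]
    exact hmarkov.trans hprod
  refine le_trans (pr_mono fun ω => ?_) hpr
  rintro ⟨z, hyz, hz⟩
  by_contra hlt
  push Not at hlt
  -- Each regularised energy is at least a constant over Y, and 1/Y ≥ 1 − log Y makes the sum over
  -- groups depend only on the product of the Y.
  have hkey : ∀ g, 0 < Y (ω g) ∧ m / N * ‖y‖ ^ 2 * (20 / 21) * (1 - Real.log (Y (ω g))) ≤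
      energy a (ω g) z + 20 * β * ‖z‖ ^ 2 := by
    intro g
    have h1 := sq_le_mul_defect a (c := m / N) (by positivity) hl (ω g) hyz
    have hE : 0 ≤ energy a (ω g) z + 20 * β * ‖z‖ ^ 2 :=
      add_nonneg (energy_nonneg _ _ _) (by positivity)
    have h2 : 0 < (m / N * ‖y‖ ^ 2) ^ 2 := by positivity
    have hd : 0 < defect a (m / N) (20 * β) y (ω g) := by
      by_contra hneg
      have := mul_nonpos_of_nonneg_of_nonpos hE (not_lt.1 hneg)
      linarith
    have hYpos : 0 < Y (ω g) := mul_pos hc0 hd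
    refine ⟨hYpos, ?_⟩
    have h3 : 1 - Real.log (Y (ω g)) ≤ (Y (ω g))⁻¹ := by
      have := Real.log_le_sub_one_of_pos (inv_pos.2 hYpos)
      rw [Real.log_inv] at this
      linarith
    calc _ ≤ m / N * ‖y‖ ^ 2 * (20 / 21) * (Y (ω g))⁻¹ := by gcongr
      _ = (m / N * ‖y‖ ^ 2) ^ 2 / defect a (m / N) (20 * β) y (ω g) := by
          simp only [Y, hc]; field_simp
      _ ≤ _ := by rw [div_le_iff₀ hd]; exact h1
  have hlog : ∑ g, Real.log (Y (ω g)) ≤ G / 20 := by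
    rw [← Real.log_prod fun g _ => (hkey g).1.ne']
    have hpos : 0 < ∏ g, Y (ω g) := prod_pos fun g _ => (hkey g).1
    exact ((Real.log_lt_iff_lt_exp hpos).2 hlt).le
  have hsum := sum_le_sum fun g (_ : g ∈ univ) => (hkey g).2
  rw [← mul_sum, sum_sub_distrib, sum_add_distrib] at hsum
  simp only [sum_const, card_univ, Fintype.card_fin, nsmul_eq_mul, mul_one] at hsum
  have h4 : m / N * ‖y‖ ^ 2 * (20 / 21) * (G - G / 20) ≤
      m / N * ‖y‖ ^ 2 * (20 / 21) * (G - ∑ g, Real.log (Y (ω g))) := by gcongr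
  have h5 : m / N * ‖y‖ ^ 2 * (20 / 21) * (G - G / 20) = 19 / 21 * (G * m / N) * ‖y‖ ^ 2 := by
    ring
  have h6 : G * (20 * β) * ‖z‖ ^ 2 = G * (20 * β * ‖z‖ ^ 2) := by ring
  rw [h6] at hz
  linarith

/-- With high probability, every vector whose orthogonal projection to the line of `y` is `y` has at
least three quarters of the expected energy of `y`. -/
theorem pr_exists_energy_lt_le [FiniteDimensional ℂ H] {β : ℝ} (hβ : 0 < β)
    (hb : ∀ i, ‖a i‖ ^ 2 ≤ β) (hNβ : 1 ≤ Fintype.card ι * β) {G m : ℕ} (hG : 0 < G)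
    (hm : 20 * G ≤ m) (y : H) :
    pr (fun ω : Fin m → ι => ∃ z, ⟪y, z⟫_ℂ = ((‖y‖ ^ 2 : ℝ) : ℂ) ∧
      energy a ω z < 3 / 4 * (m / Fintype.card ι) * ‖y‖ ^ 2) ≤
      4 * (Module.finrank ℂ H * Real.exp (-(m / (Fintype.card ι * β) / (1600 * G)))) +
        Real.exp (-(G / 20)) := by
  classical
  have hN : (0 : ℝ) < Fintype.card ι := by exact_mod_cast Fintype.card_pos
  have hG' : (1 : ℝ) ≤ G := by exact_mod_cast hG
  set N : ℝ := (Fintype.card ι : ℝ) with hNdef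
  set m₀ := m / G with hm₀
  have hGm : G * m₀ ≤ m := Nat.mul_div_le m G
  -- Equal groups leave fewer than G ≤ m/20 samples unused.
  have hGm' : (19 / 20 : ℝ) * m ≤ G * m₀ := by
    have h1 : m < G * m₀ + G := by
      have := Nat.lt_mul_div_succ m hG
      rw [mul_add, mul_one] at this
      exact this
    have h1' : (m : ℝ) < G * m₀ + G := by exact_mod_cast h1
    have h2 : (20 * G : ℝ) ≤ m := by exact_mod_cast hm
    linarith
  -- Chosen so that 20Gβ · 4s = 1/20: the regularisation then costs at most a twentieth of the
  -- energy of z.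
  set s : ℝ := (1600 * G * β)⁻¹ with hs
  have hs0 : 0 < s := by positivity
  have hsβ : s * β ≤ 1 := by
    have : s * β = (1600 * G : ℝ)⁻¹ := by rw [hs]; field_simp
    rw [this]; exact inv_le_one_of_one_le₀ (by linarith)
  have hsN : s ≤ N := by
    rw [hs]
    refine inv_le_of_inv_le₀ hN ?_
    rw [inv_le_iff_one_le_mul₀ hN]
    nlinarith
  have hA := pr_energy_lt_le ha hs0 hsβ hb hsN m
  let e : Fin G × Fin m₀ ↪ Fin m :=
    finProdFinEquiv.toEmbedding.trans (Fin.castLEEmb hGm)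
  have hB : pr (fun ω : Fin m → ι => ∃ z, ⟪y, z⟫_ℂ = ((‖y‖ ^ 2 : ℝ) : ℂ) ∧
      ∑ g, energy a (fun t => ω (e (g, t))) z + G * (20 * β) * ‖z‖ ^ 2 <
        19 / 21 * (G * m₀ / N) * ‖y‖ ^ 2) ≤ Real.exp (-(G / 20)) := by
    refine le_trans (le_of_eq ?_) (pr_groups_le ha hβ hb G m₀ y)
    let P : (Fin G → Fin m₀ → ι) → Prop := fun ω => ∃ z, ⟪y, z⟫_ℂ = ((‖y‖ ^ 2 : ℝ) : ℂ) ∧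
      ∑ g, energy a (ω g) z + G * (20 * β) * ‖z‖ ^ 2 < 19 / 21 * (G * m₀ / N) * ‖y‖ ^ 2
    calc _ = 𝔼 ω : Fin m → ι, (fun ω' : Fin G × Fin m₀ → ι =>
          if P (fun g t => ω' (g, t)) then (1 : ℝ) else 0) (ω ∘ e) := rfl
      _ = 𝔼 ω' : Fin G × Fin m₀ → ι, if P (fun g t => ω' (g, t)) then (1 : ℝ) else 0 :=
          expect_comp_embedding e fun ω' : Fin G × Fin m₀ → ι =>
            if P (fun g t => ω' (g, t)) then (1 : ℝ) else 0
      _ = pr P := Fintype.expect_equiv (Equiv.curry _ _ _) _ _ fun ω' => rfl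
  have hexp : (1 - s / N) ^ m ≤ Real.exp (-(m / (N * β) / (1600 * G))) := by
    have h1 : 0 ≤ 1 - s / N := sub_nonneg.2 ((div_le_one hN).2 hsN)
    have h2 : 1 - s / N ≤ Real.exp (-(s / N)) := by
      have := Real.add_one_le_exp (-(s / N)); linarith
    refine (pow_le_pow_left₀ h1 h2 m).trans (le_of_eq ?_)
    rw [← Real.exp_nat_mul]
    congr 1
    rw [hs]; field_simp
  have hmono := pr_mono (p := fun ω : Fin m → ι => ∃ z, ⟪y, z⟫_ℂ = ((‖y‖ ^ 2 : ℝ) : ℂ) ∧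
      energy a ω z < 3 / 4 * (m / N) * ‖y‖ ^ 2)
    (q := fun ω : Fin m → ι => (∃ v : H, 4 * s * energy a ω v < ‖v‖ ^ 2) ∨
      ∃ z, ⟪y, z⟫_ℂ = ((‖y‖ ^ 2 : ℝ) : ℂ) ∧
      ∑ g, energy a (fun t => ω (e (g, t))) z + G * (20 * β) * ‖z‖ ^ 2 <
        19 / 21 * (G * m₀ / N) * ‖y‖ ^ 2) ?_
  · refine hmono.trans ((pr_or_le _ _).trans (add_le_add (hA.trans ?_) hB))
    gcongr
  · rintro ω ⟨z, hyz, hz⟩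
    by_contra hcon
    push Not at hcon
    have h1 := hcon.1 z
    have h2 := hcon.2 z hyz
    have h3 : ∑ g, energy a (fun t => ω (e (g, t))) z ≤ energy a ω z := by
      have h4 : ∑ g, energy a (fun t => ω (e (g, t))) z =
          ∑ x : Fin G × Fin m₀, ‖⟪a (ω (e x)), z⟫_ℂ‖ ^ 2 := by
        rw [Fintype.sum_prod_type]; rfl
      rw [h4, ← sum_map univ e fun t => ‖⟪a (ω t), z⟫_ℂ‖ ^ 2]
      exact sum_le_sum_of_subset_of_nonneg (subset_univ _) fun _ _ _ => sq_nonneg _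
    have h5 : G * (20 * β) * ‖z‖ ^ 2 ≤ energy a ω z / 20 := by
      calc G * (20 * β) * ‖z‖ ^ 2 ≤ G * (20 * β) * (4 * s * energy a ω z) := by gcongr
        _ = energy a ω z / 20 := by rw [hs]; field_simp; norm_num
    -- Altogether (21/20) · energy ≥ (361/420)(m/N)‖y‖², and 361/441 > 3/4.
    have h6 : 19 / 21 * (19 / 20 * m / N) * ‖y‖ ^ 2 ≤ 19 / 21 * (G * m₀ / N) * ‖y‖ ^ 2 := by
      gcongr
    have h7 : 0 ≤ m / N * ‖y‖ ^ 2 := by positivity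
    have h8 : 19 / 21 * (19 / 20 * m / N) * ‖y‖ ^ 2 = 361 / 420 * (m / N * ‖y‖ ^ 2) := by ring
    have h9 : 3 / 4 * (m / N) * ‖y‖ ^ 2 = 3 / 4 * (m / N * ‖y‖ ^ 2) := by ring
    rw [h8] at h6; rw [h9] at hz
    linarith

end Random

end FrameSampling

/-! The discrete Fourier transform of lateral slices -/

namespace AdaptiveSampling

open Finset FiniteProb FrameSampling Tensor
open scoped BigOperators InnerProductSpace

variable {N₁ N₂ N₃ : ℕ} [NeZero N₃]

theorem sum_conj_dft_mul_dft (f g : ZMod N₃ → ℂ) :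
    ∑ k, (starRingEnd ℂ) (ZMod.dft f k) * ZMod.dft g k =
      N₃ * ∑ l, (starRingEnd ℂ) (f l) * g l := by
  have h1 : ∀ l, ∑ k, ZMod.stdAddChar (l * k) * ZMod.dft g k = N₃ * g l := fun l => by
    have := congrFun (ZMod.dft_dft g) (-l)
    rw [ZMod.dft_apply, neg_neg, smul_eq_mul] at this
    rw [← this]
    refine sum_congr rfl fun k _ => ?_
    rw [smul_eq_mul]; congr 2; ring
  simp only [ZMod.dft_apply f, map_sum, sum_mul, smul_eq_mul, map_mul]
  rw [sum_comm, mul_sum]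
  refine sum_congr rfl fun l _ => ?_
  rw [mul_left_comm, ← h1, mul_sum]
  refine sum_congr rfl fun k _ => ?_
  rw [← AddChar.map_neg_eq_conj, neg_neg]; ring

theorem dft_circConv (a b : ZMod N₃ → ℝ) (k : ZMod N₃) :
    ZMod.dft (fun n => (circConv a b n : ℂ)) k =
      ZMod.dft (fun n => (a n : ℂ)) k * ZMod.dft (fun n => (b n : ℂ)) k := by
  simp only [ZMod.dft_apply, circConv, smul_eq_mul, sum_mul, Complex.ofReal_sum, mul_sum]
  conv_rhs => rw [sum_comm]
  rw [sum_comm]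
  refine sum_congr rfl fun l _ => ?_
  rw [← Equiv.sum_comp (Equiv.addRight l)]
  refine sum_congr rfl fun n _ => ?_
  simp only [Equiv.coe_addRight, add_sub_cancel_right]
  rw [show -((n + l) * k) = -(l * k) + -(n * k) by ring, AddChar.map_add_eq_mul]
  push_cast; ring

theorem dft_comp_neg_real (a : ZMod N₃ → ℝ) (k : ZMod N₃) :
    ZMod.dft (fun n => ((a (-n) : ℝ) : ℂ)) k =
      (starRingEnd ℂ) (ZMod.dft (fun n => (a n : ℂ)) k) := by
  simp only [ZMod.dft_apply, smul_eq_mul, map_sum, map_mul, Complex.conj_ofReal]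
  rw [← Equiv.sum_comp (Equiv.neg (ZMod N₃))]
  refine sum_congr rfl fun n _ => ?_
  rw [← AddChar.map_neg_eq_conj]; simp

/-- The `k`-th frontal slice of the Fourier transform of a lateral slice. -/
noncomputable def blk (k : ZMod N₃) : Slice N₁ N₃ →ₗ[ℝ] EuclideanSpace ℂ (Fin N₁) where
  toFun x := WithLp.toLp 2 fun i => ZMod.dft (fun l => (x (i, l) : ℂ)) k
  map_add' x y := by
    ext i
    simp [ZMod.dft_apply, mul_add, sum_add_distrib]
  map_smul' c x := by
    ext i
    simp [ZMod.dft_apply, mul_sum, mul_left_comm]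

theorem blk_apply (k : ZMod N₃) (x : Slice N₁ N₃) (i : Fin N₁) :
    blk k x i = ZMod.dft (fun l => (x (i, l) : ℂ)) k := rfl

theorem sum_norm_blk_apply_sq (x : Slice N₁ N₃) (i : Fin N₁) :
    ∑ k, ‖blk k x i‖ ^ 2 = N₃ * ∑ l, x (i, l) ^ 2 := by
  have := sum_conj_dft_mul_dft (fun l => (x (i, l) : ℂ)) (fun l => (x (i, l) : ℂ))
  simp only [Complex.conj_mul', ← blk_apply, Complex.norm_real, Real.norm_eq_abs] at this
  simp only [← Complex.ofReal_pow, sq_abs] at this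
  exact_mod_cast this

theorem norm_sq_slice (x : Slice N₁ N₃) : ‖x‖ ^ 2 = ∑ i, ∑ l, x (i, l) ^ 2 := by
  rw [EuclideanSpace.norm_sq_eq, Fintype.sum_prod_type]
  simp

theorem sum_norm_blk_sq (x : Slice N₁ N₃) : ∑ k, ‖blk k x‖ ^ 2 = N₃ * ‖x‖ ^ 2 := by
  simp only [EuclideanSpace.norm_sq_eq (blk _ x)]
  rw [sum_comm, norm_sq_slice, mul_sum]
  exact sum_congr rfl fun i _ => sum_norm_blk_apply_sq x i

theorem blk_sliceMul (k : ZMod N₃) (x : Slice N₁ N₃) (c : ZMod N₃ → ℝ) :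
    blk k (sliceMul x c) = ZMod.dft (fun l => (c l : ℂ)) k • blk k x := by
  ext i
  rw [PiLp.smul_apply, smul_eq_mul, mul_comm]
  exact dft_circConv (fun l => x (i, l)) c k

theorem inner_slice (x y : Slice N₁ N₃) : ⟪x, y⟫_ℝ = ∑ i, ∑ l, x (i, l) * y (i, l) := by
  rw [PiLp.inner_apply, Fintype.sum_prod_type]
  simp [mul_comm]

theorem sum_inner_blk (x y : Slice N₁ N₃) :
    ∑ k, ⟪blk k x, blk k y⟫_ℂ = ((N₃ * ⟪x, y⟫_ℝ : ℝ) : ℂ) := by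
  simp only [PiLp.inner_apply (𝕜 := ℂ)]
  rw [sum_comm, inner_slice]
  push_cast
  rw [mul_sum]
  refine sum_congr rfl fun i _ => ?_
  have := sum_conj_dft_mul_dft (fun l => (x (i, l) : ℂ)) (fun l => (y (i, l) : ℂ))
  simp only [Complex.conj_ofReal] at this
  rw [← this]
  refine sum_congr rfl fun k _ => ?_
  rw [RCLike.inner_apply', blk_apply, blk_apply]

/-- Slices that are orthogonal to all t-multiples of `x` are orthogonal to `x` in every block. -/
theorem inner_blk_eq_zero {x y : Slice N₁ N₃} (h : ∀ c, ⟪sliceMul x c, y⟫_ℝ = 0) (k : ZMod N₃) :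
    ⟪blk k x, blk k y⟫_ℂ = 0 := by
  let q : ZMod N₃ → ℂ := fun k => ⟪blk k x, blk k y⟫_ℂ
  suffices hq : ZMod.dft q = 0 by
    have : q = 0 := (LinearEquiv.map_eq_zero_iff _).1 hq
    exact congrFun this k
  funext l
  -- Multiplying by the unit tube at −l twists slice k of x by a character, so Parseval identifies
  -- the l-th Fourier coefficient of q with a pairing assumed to vanish.
  have h1 := sum_inner_blk (sliceMul x (Pi.single (-l) 1)) y
  rw [h] at h1
  simp only [blk_sliceMul, inner_smul_left] at h1
  rw [ZMod.dft_apply]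
  simp only [mul_zero, Complex.ofReal_zero] at h1
  rw [Pi.zero_apply, ← h1]
  refine sum_congr rfl fun k _ => ?_
  rw [ZMod.dft_apply, smul_eq_mul]
  congr 1
  rw [sum_eq_single (-l)]
  · rw [Pi.single_eq_same, smul_eq_mul, map_mul, ← AddChar.map_neg_eq_conj]
    simp only [Complex.ofReal_one, map_one, mul_one]
    congr 1; ring
  · intro b _ hb
    rw [Pi.single_eq_of_ne hb]; simp
  · simp

/-! Column spaces of the first factor of a t-SVD -/

/-- The transform turns the t-product into the matrix product of frontal slices and `ttranspose`
into the conjugate transpose, so Uᵀ ∗ U = I can be read slice by slice. -/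
theorem inner_blk_lateral {U : Tensor N₁ N₁ N₃} (hU : IsOrthogonal U) (k : ZMod N₃)
    (c c' : Fin N₁) :
    ⟪blk k (lateral U c), blk k (lateral U c')⟫_ℂ = if c = c' then 1 else 0 := by
  have h1 := congrFun (congrFun hU.1 c) c'
  have h2 : ZMod.dft (fun n => ((tone N₁ N₃ c c' n : ℝ) : ℂ)) k = if c = c' then 1 else 0 := by
    rw [ZMod.dft_apply, sum_eq_single 0]
    · by_cases h : c = c' <;> simp [tone, h]
    · intro b _ hb; simp [tone, hb]
    · simp
  rw [← h2, ← h1]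
  have h3 : ∀ n, Tensor.tprod (ttranspose U) U c c' n =
      ∑ i, circConv (fun l => U i c (-l)) (U i c') n := fun n => by
    simp [Tensor.tprod]; rfl
  simp only [h3, PiLp.inner_apply, Complex.ofReal_sum]
  have h4 : (fun n => ∑ i, ((circConv (fun l => U i c (-l)) (U i c') n : ℝ) : ℂ)) =
      ∑ i, fun n => ((circConv (fun l => U i c (-l)) (U i c') n : ℝ) : ℂ) := by
    funext n; simp
  rw [h4, map_sum, Finset.sum_apply]
  refine sum_congr rfl fun i _ => ?_
  rw [dft_circConv, dft_comp_neg_real (U i c), RCLike.inner_apply']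
  rfl

theorem orthonormal_blk_lateral {U : Tensor N₁ N₁ N₃} (hU : IsOrthogonal U) (k : ZMod N₃) :
    Orthonormal ℂ fun c => blk k (lateral U c) :=
  orthonormal_iff_ite.2 (inner_blk_lateral hU k)

/-- The span of the first `r` columns of the `k`-th frontal slice of the Fourier transform. -/
noncomputable def colSpace (U : Tensor N₁ N₁ N₃) (r : ℕ) (k : ZMod N₃) :
    Submodule ℂ (EuclideanSpace ℂ (Fin N₁)) :=
  Submodule.span ℂ ((fun c => blk k (lateral U c)) ''
    ((univ.filter fun c : Fin N₁ => (c : ℕ) < r : Finset (Fin N₁)) : Set (Fin N₁)))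

theorem finrank_colSpace_le (U : Tensor N₁ N₁ N₃) (r : ℕ) (k : ZMod N₃) :
    Module.finrank ℂ (colSpace U r k) ≤ r := by
  classical
  rw [colSpace, ← coe_image]
  refine (finrank_span_finset_le_card _).trans (card_image_le.trans ?_)
  have := Fin.card_filter_val_lt (n := N₁) (m := r)
  rw [this]; exact min_le_right _ _

/-- Cauchy–Schwarz in the orthonormal coordinates given by the first r columns. -/
theorem norm_apply_sq_le_of_mem_colSpace {U : Tensor N₁ N₁ N₃} (hU : IsOrthogonal U) {r : ℕ}
    {k : ZMod N₃} {β : ℝ} {i : Fin N₁}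
    (hβ : ∑ c ∈ univ.filter (fun c : Fin N₁ => (c : ℕ) < r), ‖blk k (lateral U c) i‖ ^ 2 ≤ β)
    {z : EuclideanSpace ℂ (Fin N₁)} (hz : z ∈ colSpace U r k) : ‖z i‖ ^ 2 ≤ β * ‖z‖ ^ 2 := by
  rw [colSpace] at hz
  set s := univ.filter fun c : Fin N₁ => (c : ℕ) < r
  obtain ⟨f, rfl⟩ := (Submodule.mem_span_image_finset_iff_exists_fun ℂ).1 hz
  have h1 : ((‖∑ c : s, f c • blk k (lateral U c)‖ ^ 2 : ℝ) : ℂ) =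
      ((∑ c : s, ‖f c‖ ^ 2 : ℝ) : ℂ) := by
    have := ((orthonormal_blk_lateral hU k).comp (Subtype.val : s → Fin N₁)
      Subtype.val_injective).inner_sum f f univ
    simp only [Function.comp_apply] at this
    rw [inner_self_eq_norm_sq_to_K] at this
    simp only [Complex.conj_mul'] at this
    push_cast
    exact this
  rw [Complex.ofReal_inj] at h1
  rw [h1]
  have h2 : (∑ c : s, f c • blk k (lateral U c)) i = ∑ c : s, f c * blk k (lateral U c) i := by
    simp [WithLp.ofLp_sum, Finset.sum_apply]
  rw [h2]
  rw [← sum_coe_sort s fun c => ‖blk k (lateral U c) i‖ ^ 2] at hβ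
  calc ‖∑ c : s, f c * blk k (lateral U c) i‖ ^ 2
      ≤ (∑ c : s, ‖f c‖ * ‖blk k (lateral U c) i‖) ^ 2 := by
        refine pow_le_pow_left₀ (norm_nonneg _) ((norm_sum_le _ _).trans (le_of_eq ?_)) 2
        simp only [norm_mul]
    _ ≤ (∑ c : s, ‖f c‖ ^ 2) * ∑ c : s, ‖blk k (lateral U c) i‖ ^ 2 :=
        sum_mul_sq_le_sq_mul_sq _ _ _
    _ ≤ _ := by
        rw [mul_comm]
        exact mul_le_mul_of_nonneg_right hβ (sum_nonneg fun _ _ => sq_nonneg _)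

theorem sum_norm_blk_le_of_coherence_le {U : Tensor N₁ N₁ N₃} {r : ℕ} {μ₀ : ℝ} (hr : 0 < r)
    (hμ : coherence U r ≤ μ₀) (i : Fin N₁) (k : ZMod N₃) :
    ∑ c ∈ univ.filter (fun c : Fin N₁ => (c : ℕ) < r), ‖blk k (lateral U c) i‖ ^ 2 ≤
      μ₀ * r / N₁ := by
  have hN : (0 : ℝ) < N₁ := by exact_mod_cast i.pos
  have hr' : (0 : ℝ) < r := by exact_mod_cast hr
  have h1 : ∑ c ∈ univ.filter (fun c : Fin N₁ => (c : ℕ) < r), ‖blk k (lateral U c) i‖ ^ 2 ≤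
      ⨆ p : Fin N₁ × ZMod N₃, ∑ c ∈ univ.filter (fun c : Fin N₁ => (c : ℕ) < r),
        ‖fft (ttranspose U) c p.1 p.2‖ ^ 2 := by
    refine le_trans (le_of_eq ?_) (le_ciSup (Finite.bddAbove_range _) (i, k))
    refine sum_congr rfl fun c _ => ?_
    have : fft (ttranspose U) c i k = (starRingEnd ℂ) (blk k (lateral U c) i) :=
      dft_comp_neg_real (U i c) k
    rw [this, RCLike.norm_conj]
  rw [coherence, div_mul_eq_mul_div, div_le_iff₀ hr'] at hμ
  rw [le_div_iff₀ hN, mul_comm]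
  exact (mul_le_mul_of_nonneg_left h1 hN.le).trans hμ

/-- A non-zero tube at i forces the i + 1 tubes up to i to be non-zero, by monotonicity. -/
theorem diagTube_eq_zero {Θ : Tensor N₁ N₂ N₃}
    (hdec : ∀ i i' : Fin (min N₁ N₂), i ≤ i' →
      ∑ k, diagTube Θ i' k ^ 2 ≤ ∑ k, diagTube Θ i k ^ 2) (i : Fin (min N₁ N₂))
    (hi : numNonzeroTubes Θ ≤ i) : diagTube Θ i = 0 := by
  classical
  by_contra hne
  have hpos : 0 < ∑ k, diagTube Θ i k ^ 2 := by
    obtain ⟨k, hk⟩ := Function.ne_iff.1 hne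
    exact sum_pos' (fun _ _ => sq_nonneg _) ⟨k, mem_univ _, by
      have : diagTube Θ i k ≠ 0 := hk
      positivity⟩
  have hsub : Finset.Iic i ⊆ univ.filter fun i => diagTube Θ i ≠ 0 := by
    intro i' hi'
    refine mem_filter.2 ⟨mem_univ _, fun h0 => ?_⟩
    have := hdec i' i (mem_Iic.1 hi')
    rw [h0] at this
    simp at this
    linarith
  have h1 := card_le_card hsub
  rw [Fin.card_Iic] at h1
  have h2 : numNonzeroTubes Θ = (univ.filter fun i => diagTube Θ i ≠ 0).card := by
    rw [numNonzeroTubes]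
  omega

theorem numNonzeroTubes_le (Θ : Tensor N₁ N₂ N₃) : numNonzeroTubes Θ ≤ min N₁ N₂ := by
  rw [numNonzeroTubes]
  exact (card_filter_le _ _).trans (by simp)

/-- In slice k the column is a combination of the columns of U with coefficients from ΘVᵀ, and the
rows of Θ beyond the tubal-rank vanish. -/
theorem blk_lateral_mem_colSpace {T : Tensor N₁ N₂ N₃} {U : Tensor N₁ N₁ N₃}
    {Θ : Tensor N₁ N₂ N₃} {V : Tensor N₂ N₂ N₃} (h : IsTSVD T U Θ V) (j : Fin N₂)
    (k : ZMod N₃) : blk k (lateral T j) ∈ colSpace U (numNonzeroTubes Θ) k := by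
  have hΘ : ∀ (c : Fin N₁) (d : Fin N₂), numNonzeroTubes Θ ≤ c → Θ c d = 0 := by
    intro c d hc
    by_cases hcd : (c : ℕ) = d
    · have := diagTube_eq_zero h.decreasing ⟨c, lt_min c.2 (hcd ▸ d.2)⟩ hc
      rw [← this, diagTube]
      congr 1
      exact Fin.ext hcd.symm
    · exact h.fDiagonal c d hcd
  let D : (ZMod N₃ → ℝ) → ℂ := fun a => ZMod.dft (fun n => (a n : ℂ)) k
  have hDsum : ∀ {α : Type} (s : Finset α) (f : α → ZMod N₃ → ℝ), D (∑ c ∈ s, f c) =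
      ∑ c ∈ s, D (f c) := by
    intro α s f
    have : (fun n => (((∑ c ∈ s, f c) n : ℝ) : ℂ)) = ∑ c ∈ s, fun n => ((f c n : ℝ) : ℂ) := by
      funext n; simp
    simp only [D]
    rw [this, map_sum, Finset.sum_apply]
  have key : blk k (lateral T j) = ∑ c : Fin N₁,
      (∑ d, D (Θ c d) * D (ttranspose V d j)) • blk k (lateral U c) := by
    ext i
    have h1 : blk k (lateral T j) i = D (T i j) := rfl
    have h2 : ∀ c, blk k (lateral U c) i = D (U i c) := fun c => rfl
    simp only [WithLp.ofLp_sum, Finset.sum_apply, PiLp.smul_apply, smul_eq_mul]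
    rw [h1, h.eq_tprod]
    simp only [Tensor.tprod, hDsum, h2]
    have h3 : ∀ a b, D (circConv a b) = D a * D b := fun a b => dft_circConv a b k
    simp only [h3, hDsum, sum_mul]
    rw [sum_comm]
    exact sum_congr rfl fun c _ => sum_congr rfl fun d _ => by ring
  rw [key]
  refine Submodule.sum_mem _ fun c _ => ?_
  by_cases hc : (c : ℕ) < numNonzeroTubes Θ
  · exact Submodule.smul_mem _ _ (Submodule.subset_span ⟨c, by simpa using hc, rfl⟩)
  · have : ∑ d, D (Θ c d) * D (ttranspose V d j) = 0 := by
      refine sum_eq_zero fun d _ => ?_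
      have h0 : D (Θ c d) = 0 := by
        rw [hΘ c d (not_lt.1 hc)]
        simp [D, ZMod.dft_apply]
      rw [h0, zero_mul]
    rw [this, zero_smul]
    exact Submodule.zero_mem _

end AdaptiveSampling

/-! Sampled residual energies for a fixed tensor-column subspace -/

namespace AdaptiveSampling

open Finset FiniteProb FrameSampling Tensor
open scoped BigOperators InnerProductSpace

variable {N₁ N₂ N₃ : ℕ} [NeZero N₃]

/-- Row sampling in an incoherent subspace of `ℂ^N`. -/
theorem pr_rows_lt_le [NeZero N₁] {W : Submodule ℂ (EuclideanSpace ℂ (Fin N₁))} {r : ℕ}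
    (hr : Module.finrank ℂ W ≤ r) {β : ℝ} (hβ : 0 < β) (hNβ : 1 ≤ N₁ * β)
    (hW : ∀ z ∈ W, ∀ i, ‖z i‖ ^ 2 ≤ β * ‖z‖ ^ 2) {G m : ℕ} (hG : 0 < G) (hm : 20 * G ≤ m)
    {y : EuclideanSpace ℂ (Fin N₁)} (hy : y ∈ W) :
    pr (fun ω : Fin m → Fin N₁ => ∃ z ∈ W, ⟪y, z⟫_ℂ = ((‖y‖ ^ 2 : ℝ) : ℂ) ∧
      ∑ t, ‖z (ω t)‖ ^ 2 < 3 / 4 * (m / N₁) * ‖y‖ ^ 2) ≤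
      4 * (r * Real.exp (-(m / (N₁ * β) / (1600 * G)))) + Real.exp (-(G / 20)) := by
  let e : Fin N₁ → EuclideanSpace ℂ (Fin N₁) := fun i => EuclideanSpace.single i 1
  -- The projected standard basis is a Parseval frame of W whose coefficients are the entries, so
  -- energies of samples are energies on rows.
  let a : Fin N₁ → W := fun i => W.orthogonalProjectionOnto (e i)
  have hinner : ∀ i (z : W), ⟪a i, z⟫_ℂ = (z : EuclideanSpace ℂ (Fin N₁)) i := fun i z => by
    refine (Submodule.inner_orthogonalProjectionOnto_eq_of_mem_right z (e i)).trans ?_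
    simp [e, EuclideanSpace.inner_single_left]
  have ha : ∀ z : W, ∑ i, ⟪a i, z⟫_ℂ • a i = z := fun z => by
    simp only [hinner, a, ← map_smul, ← map_sum]
    have : ∑ i, (z : EuclideanSpace ℂ (Fin N₁)) i • e i = z := by
      ext j
      simp [e, WithLp.ofLp_sum, Finset.sum_apply, Pi.single_apply]
    rw [this]
    exact Submodule.orthogonalProjectionOnto_mem_subspace_eq_self z
  have hb : ∀ i, ‖a i‖ ^ 2 ≤ β := fun i => by
    rcases eq_or_ne (a i) 0 with h0 | h0
    · rw [h0]; simpa using hβ.le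
    have h1 : ((‖a i‖ ^ 2 : ℝ) : ℂ) = (a i : EuclideanSpace ℂ (Fin N₁)) i := by
      rw [← hinner]
      exact_mod_cast (inner_self_eq_norm_sq_to_K (𝕜 := ℂ) (a i)).symm
    -- Incoherence applied to aᵢ itself, whose i-th entry is ‖aᵢ‖², gives ‖aᵢ‖⁴ ≤ β‖aᵢ‖².
    have h2 := hW _ (a i).2 i
    rw [← h1, Complex.norm_real, Real.norm_eq_abs, sq_abs, ← Submodule.coe_norm] at h2
    have h3 : 0 < ‖a i‖ ^ 2 := by positivity
    nlinarith
  have key := pr_exists_energy_lt_le ha hβ hb (by simpa using hNβ) hG hm ⟨y, hy⟩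
  simp only [Fintype.card_fin] at key
  refine (pr_mono fun ω => ?_).trans (key.trans ?_)
  · rintro ⟨z, hz, hyz, hlt⟩
    refine ⟨⟨z, hz⟩, hyz, ?_⟩
    simp only [energy, hinner]
    exact hlt
  · have : (Module.finrank ℂ W : ℝ) ≤ r := by exact_mod_cast hr
    gcongr

/-- A Chernoff bound for the upper tail of a sum of samples. -/
theorem pr_lt_sum_le {ι : Type*} [Fintype ι] [Nonempty ι] {f : ι → ℝ} {β S : ℝ} (hβ : 0 < β)
    (hf : ∀ i, 0 ≤ f i) (hS : ∑ i, f i = S) (hfβ : ∀ i, f i ≤ β * S) (m : ℕ) :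
    pr (fun ω : Fin m → ι => 5 / 4 * (m / Fintype.card ι) * S < ∑ t, f (ω t)) ≤
      Real.exp (-(m / (Fintype.card ι * β) / 64)) := by
  have hN : (0 : ℝ) < Fintype.card ι := by exact_mod_cast Fintype.card_pos
  set N : ℝ := (Fintype.card ι : ℝ) with hNdef
  rcases eq_or_lt_of_le (hS ▸ sum_nonneg fun i _ => hf i : 0 ≤ S) with h0 | h0
  · refine le_trans (le_of_eq ?_) (Real.exp_pos _).le
    rw [pr]
    refine Finset.expect_eq_zero fun ω _ => if_neg ?_
    have : ∀ i, f i = 0 := fun i => le_antisymm (by simpa [← h0] using hfβ i) (hf i)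
    simp [this, ← h0]
  -- With this θ all exponents are at most 1/8, where eˣ ≤ 1 + 9x/8. The final exponent is 9/64 −
  -- 10/64 = −1/64 times m/(Nβ).
  set θ : ℝ := (8 * β * S)⁻¹ with hθ
  have hθ0 : 0 < θ := by positivity
  have h1 : ∀ i, Real.exp (θ * f i) ≤ 1 + 9 / 8 * θ * f i := fun i => by
    have hle : θ * f i ≤ 1 / 8 := by
      calc θ * f i ≤ θ * (β * S) := by gcongr; exact hfβ i
        _ = 1 / 8 := by rw [hθ]; field_simp
    have hnn : 0 ≤ θ * f i := mul_nonneg hθ0.le (hf i)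
    have := Real.abs_exp_sub_one_sub_id_le (x := θ * f i) (by rw [abs_of_nonneg hnn]; linarith)
    have := (abs_le.1 this).2
    nlinarith
  have h2 : 𝔼 i, Real.exp (θ * f i) ≤ Real.exp (9 / (64 * β * N)) := by
    calc 𝔼 i, Real.exp (θ * f i) ≤ 𝔼 i, (1 + 9 / 8 * θ * f i) := expect_mono h1
      _ = 9 / (64 * β * N) + 1 := by
        rw [expect_add_distrib, Fintype.expect_const, ← mul_expect,
          Fintype.expect_eq_sum_div_card, hS, hθ, ← hNdef]
        field_simp; ring
      _ ≤ _ := Real.add_one_le_exp _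
  have h3 : 𝔼 ω : Fin m → ι, Real.exp (θ * ∑ t, f (ω t)) ≤ Real.exp (9 / (64 * β * N)) ^ m := by
    simp only [mul_sum, Real.exp_sum]
    rw [expect_prod_pi fun i => Real.exp (θ * f i)]
    exact pow_le_pow_left₀ (expect_nonneg fun i _ => (Real.exp_pos _).le) h2 m
  have h4 := mul_pr_le_expect (f := fun ω : Fin m → ι => Real.exp (θ * ∑ t, f (ω t)))
    (fun ω => (Real.exp_pos _).le) (Real.exp (θ * (5 / 4 * (m / N) * S)))
  have h5 : pr (fun ω : Fin m → ι => 5 / 4 * (m / N) * S < ∑ t, f (ω t)) ≤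
      pr fun ω : Fin m → ι => Real.exp (θ * (5 / 4 * (m / N) * S)) ≤
        Real.exp (θ * ∑ t, f (ω t)) :=
    pr_mono fun ω h => Real.exp_le_exp.2 (by gcongr)
  have h6 : Real.exp (-(m / (N * β) / 64)) =
      Real.exp (9 / (64 * β * N)) ^ m / Real.exp (θ * (5 / 4 * (m / N) * S)) := by
    rw [← Real.exp_nat_mul, ← Real.exp_sub, hθ]
    congr 1
    field_simp; ring
  rw [h6, le_div_iff₀ (Real.exp_pos _), mul_comm]
  exact (mul_le_mul_of_nonneg_left h5 (Real.exp_pos _).le).trans (h4.trans h3)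

theorem norm_restrictRows_sq {m : ℕ} (ω : Fin m → Fin N₁) (x : Slice N₁ N₃) :
    ‖restrictRows ω x‖ ^ 2 = ∑ t, ∑ l, x (ω t, l) ^ 2 := norm_sq_slice _

theorem mul_norm_restrictRows_sq {m : ℕ} (ω : Fin m → Fin N₁) (x : Slice N₁ N₃) :
    N₃ * ‖restrictRows ω x‖ ^ 2 = ∑ k, ∑ t, ‖blk k x (ω t)‖ ^ 2 := by
  rw [norm_restrictRows_sq, mul_sum]
  rw [sum_comm]
  exact sum_congr rfl fun t _ => (sum_norm_blk_apply_sq x (ω t)).symm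

theorem residual_eq_sub (T : Tensor N₁ N₂ N₃) (K : Submodule ℝ (Slice N₁ N₃)) (j : Fin N₂) :
    residual T K j = lateral T j - K.starProjection (lateral T j) :=
  Submodule.starProjection_orthogonal_val _

theorem sampledSq_le {m : ℕ} (T : Tensor N₁ N₂ N₃) (K : Submodule ℝ (Slice N₁ N₃))
    (ω : Fin m → Fin N₁) (j : Fin N₂) :
    sampledSq T K ω j ≤ ‖restrictRows ω (residual T K j)‖ ^ 2 := by
  have h : restrictRows ω (lateral T j) = restrictRows ω (residual T K j) +
      restrictRows ω (K.starProjection (lateral T j)) := by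
    rw [← map_add, residual_eq_sub, sub_add_cancel]
  have h0 : (K.map (restrictRows ω))ᗮ.starProjection
      (restrictRows ω (K.starProjection (lateral T j))) = 0 := by
    refine Submodule.starProjection_orthogonal_apply_eq_zero ?_
    exact Submodule.mem_map_of_mem (Submodule.starProjection_apply_mem _ _)
  rw [sampledSq, h, map_add, h0, add_zero]
  exact pow_le_pow_left₀ (norm_nonneg _) (Submodule.norm_starProjection_apply_le _ _) 2

/-- The best fit on the sampled rows is the restriction of some element of K; it differs from the
true projection by an x ∈ K. This x depends on the sample, hence the need for bounds uniform in x.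
-/
theorem exists_sampledSq_eq {m : ℕ} (T : Tensor N₁ N₂ N₃) (K : Submodule ℝ (Slice N₁ N₃))
    (ω : Fin m → Fin N₁) (j : Fin N₂) :
    ∃ x ∈ K, sampledSq T K ω j = ‖restrictRows ω (residual T K j + x)‖ ^ 2 := by
  obtain ⟨x, hx, hxe⟩ := Submodule.mem_map.1
    (Submodule.starProjection_apply_mem (K.map (restrictRows ω)) (restrictRows ω (lateral T j)))
  refine ⟨K.starProjection (lateral T j) - x,
    K.sub_mem (Submodule.starProjection_apply_mem _ _) hx, ?_⟩
  rw [sampledSq, Submodule.starProjection_orthogonal_val, ← hxe, residual_eq_sub,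
    sub_add_sub_cancel, map_sub]

/-- With high probability, the sampled residual energy of one column is close to the expected
one, if the tensor-column subspace and the column lie in an incoherent subspace. -/
theorem pr_not_sampledSq_mem_le [NeZero N₁] {T : Tensor N₁ N₂ N₃}
    {K : Submodule ℝ (Slice N₁ N₃)} {j : Fin N₂}
    {W : ZMod N₃ → Submodule ℂ (EuclideanSpace ℂ (Fin N₁))} {r : ℕ}
    (hr : ∀ k, Module.finrank ℂ (W k) ≤ r) {β : ℝ} (hβ : 0 < β) (hNβ : 1 ≤ N₁ * β)
    (hW : ∀ k, ∀ z ∈ W k, ∀ i, ‖z i‖ ^ 2 ≤ β * ‖z‖ ^ 2)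
    (hmul : ∀ x ∈ K, ∀ c, sliceMul x c ∈ K) (hK : ∀ x ∈ K, ∀ k, blk k x ∈ W k)
    (hT : ∀ k, blk k (lateral T j) ∈ W k) {G m : ℕ} (hG : 0 < G) (hm : 20 * G ≤ m) :
    pr (fun ω : Fin m → Fin N₁ => ¬ (1 / 2 * (m / N₁) * ‖residual T K j‖ ^ 2 ≤ sampledSq T K ω j ∧
      sampledSq T K ω j ≤ 5 / 4 * (m / N₁) * ‖residual T K j‖ ^ 2)) ≤
      4 * (4 * (r * Real.exp (-(m / (N₁ * β) / (1600 * G)))) + Real.exp (-(G / 20))) +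
        Real.exp (-(m / (N₁ * β) / 64)) := by
  classical
  have hN₁ : (0 : ℝ) < N₁ := by exact_mod_cast Nat.pos_of_ne_zero (NeZero.ne N₁)
  have hN₃ : (0 : ℝ) < N₃ := by exact_mod_cast Nat.pos_of_ne_zero (NeZero.ne N₃)
  set y := residual T K j with hy
  set p : ℝ := 4 * (r * Real.exp (-(m / (N₁ * β) / (1600 * G)))) + Real.exp (-(G / 20)) with hp
  have hyW : ∀ k, blk k y ∈ W k := fun k => by
    rw [hy, residual_eq_sub, map_sub]
    exact (W k).sub_mem (hT k) (hK _ (Submodule.starProjection_apply_mem _ _) k)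
  -- Closure of K under t-multiples upgrades orthogonality to every slice, so perturbing y by K does
  -- not change its pairing with y there.
  have horth : ∀ x ∈ K, ∀ k, ⟪blk k y, blk k x⟫_ℂ = 0 := fun x hx k => by
    rw [← inner_conj_symm, inner_blk_eq_zero (fun c => ?_) k, map_zero]
    have : y ∈ Kᗮ := Submodule.starProjection_apply_mem _ _
    exact this _ (hmul x hx c)
  have hupper : pr (fun ω : Fin m → Fin N₁ =>
      5 / 4 * (m / N₁) * ‖y‖ ^ 2 < ∑ t, ∑ l, y (ω t, l) ^ 2) ≤
        Real.exp (-(m / (N₁ * β) / 64)) := by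
    have := pr_lt_sum_le (f := fun i => ∑ l, y (i, l) ^ 2) hβ
      (fun i => sum_nonneg fun _ _ => sq_nonneg _) (norm_sq_slice y).symm (fun i => ?_) m
    · simpa only [Fintype.card_fin] using this
    · refine le_of_mul_le_mul_left ?_ hN₃
      rw [← sum_norm_blk_apply_sq, mul_left_comm, ← sum_norm_blk_sq, mul_sum]
      exact sum_le_sum fun k _ => hW k _ (hyW k) i
  let bad : ZMod N₃ → (Fin m → Fin N₁) → Prop := fun k ω => ∃ z ∈ W k,
    ⟪blk k y, z⟫_ℂ = ((‖blk k y‖ ^ 2 : ℝ) : ℂ) ∧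
      ∑ t, ‖z (ω t)‖ ^ 2 < 3 / 4 * (m / N₁) * ‖blk k y‖ ^ 2
  have hbad : ∀ k, pr (bad k) ≤ p := fun k =>
    pr_rows_lt_le (hr k) hβ hNβ (hW k) hG hm (hyW k)
  -- The energy of y in the failing slices. By Markov it is below a quarter of the total except with
  -- probability 4p; the other slices then give (3/4)(3/4) = 9/16 > 1/2.
  let F : (Fin m → Fin N₁) → ℝ := fun ω => ∑ k, (if bad k ω then 1 else 0) * ‖blk k y‖ ^ 2
  have hF0 : ∀ ω, 0 ≤ F ω := fun ω =>
    sum_nonneg fun k _ => mul_nonneg (by split_ifs <;> norm_num) (sq_nonneg _)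
  have hEF : 𝔼 ω, F ω ≤ p * (N₃ * ‖y‖ ^ 2) := by
    simp only [F]
    rw [expect_sum_comm, ← sum_norm_blk_sq, mul_sum]
    refine sum_le_sum fun k _ => ?_
    rw [← expect_mul]
    exact mul_le_mul_of_nonneg_right (hbad k) (sq_nonneg _)
  have hlower : pr (fun ω : Fin m → Fin N₁ => sampledSq T K ω j < 1 / 2 * (m / N₁) * ‖y‖ ^ 2) ≤
      4 * p := by
    have hp0 : 0 ≤ p := by positivity
    rcases eq_or_lt_of_le (norm_nonneg y) with h0 | h0
    · refine le_trans (le_of_eq ?_) (by positivity : 0 ≤ 4 * p)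
      rw [pr]
      refine Finset.expect_eq_zero fun ω _ => if_neg ?_
      rw [← h0]
      have := sampledSq_nonneg T K ω j
      simpa using this
    have h1 := mul_pr_le_expect hF0 (N₃ * ‖y‖ ^ 2 / 4)
    have h2 : pr (fun ω => N₃ * ‖y‖ ^ 2 / 4 ≤ F ω) ≤ 4 * p := by
      have h3 : 0 < N₃ * ‖y‖ ^ 2 := by positivity
      refine le_of_mul_le_mul_left ?_ h3
      linarith
    refine (pr_mono fun ω hω => ?_).trans h2
    by_contra hlt
    push Not at hlt
    obtain ⟨x, hx, hxe⟩ := exists_sampledSq_eq T K ω j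
    rw [← hy] at hxe
    have h3 : ∀ k, 3 / 4 * (m / N₁) * (‖blk k y‖ ^ 2 - (if bad k ω then 1 else 0) * ‖blk k y‖ ^ 2) ≤
        ∑ t, ‖blk k (y + x) (ω t)‖ ^ 2 := by
      intro k
      split_ifs with hk
      · rw [one_mul, sub_self, mul_zero]
        exact sum_nonneg fun _ _ => sq_nonneg _
      · rw [zero_mul, sub_zero]
        by_contra hcon
        refine hk ⟨blk k (y + x), ?_, ?_, not_le.1 hcon⟩
        · rw [map_add]; exact (W k).add_mem (hyW k) (hK x hx k)
        · rw [map_add, inner_add_right, horth x hx k, add_zero, inner_self_eq_norm_sq_to_K]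
          norm_cast
    have h4 := sum_le_sum fun k (_ : k ∈ univ) => h3 k
    rw [← mul_norm_restrictRows_sq, ← hxe, ← mul_sum, sum_sub_distrib, sum_norm_blk_sq] at h4
    have h5 : 3 / 4 * (m / N₁) * (N₃ * ‖y‖ ^ 2 - N₃ * ‖y‖ ^ 2 / 4) ≤
        3 / 4 * (m / N₁) * (N₃ * ‖y‖ ^ 2 - F ω) := by gcongr
    have h6 : N₃ * sampledSq T K ω j < N₃ * (1 / 2 * (m / N₁) * ‖y‖ ^ 2) := by gcongr
    have h7 : 0 ≤ m / N₁ * (N₃ * ‖y‖ ^ 2) := by positivity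
    have h8 : (N₃ : ℝ) * (1 / 2 * (m / N₁) * ‖y‖ ^ 2) = 1 / 2 * (m / N₁ * (N₃ * ‖y‖ ^ 2)) := by ring
    have h9 : 3 / 4 * (m / N₁) * (N₃ * ‖y‖ ^ 2 - N₃ * ‖y‖ ^ 2 / 4) =
        9 / 16 * (m / N₁ * (N₃ * ‖y‖ ^ 2)) := by ring
    have h10 := h5.trans h4
    rw [h8] at h6; rw [h9] at h10
    linarith
  refine (pr_mono (q := fun ω : Fin m → Fin N₁ =>
    sampledSq T K ω j < 1 / 2 * (m / N₁) * ‖y‖ ^ 2 ∨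
      5 / 4 * (m / N₁) * ‖y‖ ^ 2 < ∑ t, ∑ l, y (ω t, l) ^ 2) fun ω h => ?_).trans
    ((pr_or_le _ _).trans (add_le_add hlower hupper))
  by_contra hcon
  push Not at hcon
  refine h ⟨hcon.1, (sampledSq_le T K ω j).trans ?_⟩
  rw [norm_restrictRows_sq]
  exact hcon.2

end AdaptiveSampling

/-! Random histories -/

namespace PathLaw

open Finset
open scoped ENNReal

section Expectation

variable {α β : Type*}

theorem tsum_bind_mul (p : PMF α) (g : α → PMF β) (f : β → ℝ≥0∞) :
    ∑' b, p.bind g b * f b = ∑' a, p a * ∑' b, g a b * f b := by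
  simp only [PMF.bind_apply, ← ENNReal.tsum_mul_right, ← ENNReal.tsum_mul_left]
  rw [ENNReal.tsum_comm]
  simp only [mul_assoc]

theorem tsum_pure_mul (b : α) (f : α → ℝ≥0∞) : ∑' a, PMF.pure b a * f a = f b := by
  rw [tsum_eq_single b fun a ha => by simp [PMF.pure_apply, ha]]
  simp

theorem tsum_map_mul (p : PMF α) (φ : α → β) (f : β → ℝ≥0∞) :
    ∑' b, p.map φ b * f b = ∑' a, p a * f (φ a) := by
  rw [← PMF.bind_pure_comp, tsum_bind_mul]
  simp only [Function.comp_apply, tsum_pure_mul]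

theorem toOuterMeasure_eq_tsum_mul (p : PMF α) (s : Set α) :
    p.toOuterMeasure s = ∑' a, p a * s.indicator 1 a := by
  rw [PMF.toOuterMeasure_apply]
  refine tsum_congr fun a => ?_
  by_cases h : a ∈ s <;> simp [h]

theorem tsum_mul_le_of_le (p : PMF α) {f : α → ℝ≥0∞} {c : ℝ≥0∞} (hf : ∀ a, f a ≤ c) :
    ∑' a, p a * f a ≤ c := by
  calc ∑' a, p a * f a ≤ ∑' a, p a * c := ENNReal.tsum_le_tsum fun a => by gcongr; exact hf a
    _ = c := by rw [ENNReal.tsum_mul_right, p.tsum_coe, one_mul]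

end Expectation

variable {α : Type*}

/-- The law of a history (most recent letter first) whose letters are drawn one after the other
from a kernel that depends on the past. -/
noncomputable def pathLaw (κ : List α → PMF α) : ℕ → PMF (List α)
  | 0 => PMF.pure []
  | l + 1 => (pathLaw κ l).bind fun h => (κ h).map fun P => P :: h

theorem tsum_pathLaw_succ_mul (κ : List α → PMF α) (l : ℕ) (f : List α → ℝ≥0∞) :
    ∑' h, pathLaw κ (l + 1) h * f h = ∑' h, pathLaw κ l h * ∑' P, κ h P * f (P :: h) := by
  rw [pathLaw, tsum_bind_mul]
  simp only [tsum_map_mul]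

theorem pathLaw_succ_cons (κ : List α → PMF α) (l : ℕ) (P : α) (h : List α) :
    pathLaw κ (l + 1) (P :: h) = pathLaw κ l h * κ h P := by
  classical
  have h1 := tsum_pathLaw_succ_mul κ l (Pi.single (P :: h) 1)
  rw [tsum_eq_single (P :: h) fun a ha => by simp [Pi.single_eq_of_ne ha],
    Pi.single_eq_same, mul_one] at h1
  rw [h1, tsum_eq_single h, tsum_eq_single P]
  · simp
  · intro Q hQ
    rw [Pi.single_eq_of_ne (by simpa using hQ), mul_zero]
  · intro h' hh'
    have : ∀ Q, (Pi.single (P :: h) 1 : List α → ℝ≥0∞) (Q :: h') = 0 := fun Q =>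
      Pi.single_eq_of_ne (by simp [hh']) _
    simp [this]

theorem pathLaw_succ_nil (κ : List α → PMF α) (l : ℕ) : pathLaw κ (l + 1) [] = 0 := by
  simp [pathLaw, PMF.bind_apply, PMF.map_apply]

/-- The probability of a history is the product of its transition probabilities, so the kernels need
to be compared only on the letters that occur. -/
theorem pathLaw_le_pathLaw {κ κ' : List α → PMF α} {G : α → Prop}
    (hκ : ∀ h P, G P → κ h P ≤ κ' h P) :
    ∀ (l : ℕ) (h : List α), (∀ P ∈ h, G P) → pathLaw κ l h ≤ pathLaw κ' l h
  | 0, _, _ => le_rfl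
  | l + 1, [], _ => by rw [pathLaw_succ_nil]; exact zero_le
  | l + 1, P :: h, hG => by
    rw [pathLaw_succ_cons, pathLaw_succ_cons]
    gcongr
    · exact pathLaw_le_pathLaw hκ l h fun Q hQ => hG Q (List.mem_cons_of_mem _ hQ)
    · exact hκ _ _ (hG P List.mem_cons_self)

/-- A union bound over the lengths of the suffixes. -/
theorem toOuterMeasure_exists_suffix_le (κ : List α → PMF α) (B : Set (List α)) : ∀ L : ℕ,
    (pathLaw κ L).toOuterMeasure {h | ∃ h', h' <:+ h ∧ h' ∈ B} ≤
      ∑ l ∈ range (L + 1), (pathLaw κ l).toOuterMeasure B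
  | 0 => by
    rw [range_one, sum_singleton]
    simp only [toOuterMeasure_eq_tsum_mul, pathLaw, tsum_pure_mul]
    by_cases hB : [] ∈ B
    · rw [Set.indicator_of_mem hB]
      exact Set.indicator_le_self' (fun _ _ => zero_le) _
    · rw [Set.indicator_of_notMem]
      · exact zero_le
      · rintro ⟨h', hs, hh'⟩
        exact hB (List.suffix_nil.1 hs ▸ hh')
  | L + 1 => by
    rw [sum_range_succ]
    refine le_trans ?_ (add_le_add_left (toOuterMeasure_exists_suffix_le κ B L) _)
    simp only [toOuterMeasure_eq_tsum_mul]
    set E : Set (List α) := {h | ∃ h', h' <:+ h ∧ h' ∈ B} with hE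
    -- Forgetting the last letter of a history of length L + 1 gives the law for length L, so both
    -- lengths can be compared on one history.
    have h1 : ∑' h, pathLaw κ L h * E.indicator 1 h =
        ∑' h, pathLaw κ (L + 1) h * E.indicator 1 h.tail := by
      rw [tsum_pathLaw_succ_mul]
      refine tsum_congr fun h => ?_
      simp only [List.tail_cons, ENNReal.tsum_mul_right, PMF.tsum_coe, one_mul]
    rw [h1, ← ENNReal.tsum_add]
    refine ENNReal.tsum_le_tsum fun h => ?_
    rw [← mul_add]
    gcongr
    by_cases hh : h ∈ E
    · obtain ⟨h', hs, hB⟩ := hh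
      cases h with
      | nil =>
        rw [List.suffix_nil] at hs
        subst hs
        simp [hB]
      | cons P t =>
        rcases List.suffix_cons_iff.1 hs with rfl | hs
        · rw [Set.indicator_of_mem hB]
          refine le_trans (Set.indicator_le_self' (fun _ _ => zero_le) _) ?_
          exact le_add_left le_rfl
        · have : (P :: t).tail ∈ E := ⟨h', hs, hB⟩
          rw [Set.indicator_of_mem this]
          refine le_trans (Set.indicator_le_self' (fun _ _ => zero_le) _) ?_
          exact le_add_right le_rfl
    · rw [Set.indicator_of_notMem hh]
      exact zero_le

/-- A history is new for a counter if it is empty or its last letter has raised the counter. -/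
def IsNew (c : List α → ℕ) : List α → Prop
  | [] => True
  | P :: h => c h < c (P :: h)

/-- Each non-empty new history raises the counter by at least 1, so the expectations telescope
against the bound n. The additional 1 is the empty history. -/
theorem sum_toOuterMeasure_isNew_le (κ : List α → PMF α) {c : List α → ℕ}
    (hc : ∀ P h, c h ≤ c (P :: h)) {n : ℕ} (hn : ∀ h, c h ≤ n) (L : ℕ) :
    ∑ l ∈ range (L + 1), (pathLaw κ l).toOuterMeasure {h | IsNew c h} ≤ n + 1 := by
  have key : ∀ L, ∑ l ∈ range (L + 1), (pathLaw κ l).toOuterMeasure {h | IsNew c h} ≤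
      1 + ∑' h, pathLaw κ L h * (c h : ℝ≥0∞) := by
    intro L
    induction L with
    | zero =>
      rw [range_one, sum_singleton]
      refine le_trans ?_ (le_add_right le_rfl)
      rw [toOuterMeasure_eq_tsum_mul]
      refine tsum_mul_le_of_le _ fun h => Set.indicator_le_self' (fun _ _ => zero_le) _
    | succ L ih =>
      rw [sum_range_succ]
      refine (add_le_add_left ih _).trans ?_
      rw [add_assoc]
      gcongr
      have h1 : ∑' h, pathLaw κ L h * (c h : ℝ≥0∞) =
          ∑' h, pathLaw κ (L + 1) h * (c h.tail : ℝ≥0∞) := by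
        rw [tsum_pathLaw_succ_mul]
        refine tsum_congr fun h => ?_
        simp only [List.tail_cons, ENNReal.tsum_mul_right, PMF.tsum_coe, one_mul]
      rw [h1, toOuterMeasure_eq_tsum_mul, ← ENNReal.tsum_add]
      refine ENNReal.tsum_le_tsum fun h => ?_
      rw [← mul_add]
      cases h with
      | nil => simp [pathLaw_succ_nil]
      | cons P t =>
        gcongr
        rw [List.tail_cons]
        by_cases hP : IsNew c (P :: t)
        · rw [Set.indicator_of_mem (show P :: t ∈ {h | IsNew c h} from hP)]
          have : c t + 1 ≤ c (P :: t) := hP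
          rw [Pi.one_apply]
          exact_mod_cast this
        · rw [Set.indicator_of_notMem (show P :: t ∉ {h | IsNew c h} from hP), add_zero]
          exact_mod_cast hc P t
  refine (key L).trans ?_
  rw [add_comm]
  gcongr
  exact tsum_mul_le_of_le _ fun h => by exact_mod_cast hn h

/-- Letters that did not raise the counter can be stripped without losing B; stripping stops at a
new history. -/
theorem exists_isNew_suffix {c : List α → ℕ} {B : List α → Prop} (hc : ∀ P h, c h ≤ c (P :: h))
    (hB : ∀ P h, c (P :: h) = c h → B (P :: h) → B h) :
    ∀ h, B h → ∃ h', h' <:+ h ∧ IsNew c h' ∧ B h'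
  | [], h0 => ⟨[], List.suffix_rfl, trivial, h0⟩
  | P :: h, h0 => by
    by_cases hP : IsNew c (P :: h)
    · exact ⟨P :: h, List.suffix_rfl, hP, h0⟩
    · obtain ⟨h', hs, hh'⟩ := exists_isNew_suffix hc hB h
        (hB P h (le_antisymm (not_lt.1 hP) (hc P h)) h0)
      exact ⟨h', hs.trans (List.suffix_cons P h), hh'⟩

/-- Averaging over one coordinate that a weight does not depend on. -/
theorem sum_mul_coordinate_le {J X : Type*} [Fintype J] [DecidableEq J] [Fintype X] [Nonempty X]
    {j : J} {Q : (J → X) → ℝ≥0∞} (hQ : ∀ Ω x, Q (Function.update Ω j x) = Q Ω)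
    {b : X → ℝ≥0∞} {p : ℝ≥0∞} (hb : ∑ x, b x ≤ p * Fintype.card X) :
    ∑ Ω, Q Ω * b (Ω j) ≤ p * ∑ Ω, Q Ω := by
  have hX0 : (Fintype.card X : ℝ≥0∞) ≠ 0 := by simp
  have hXt : (Fintype.card X : ℝ≥0∞) ≠ ∞ := by simp
  -- Exchanging the j-th coordinate with an independent copy leaves Q unchanged and detaches b from
  -- Ω.
  let e : (J → X) × X ≃ (J → X) × X :=
    { toFun := fun y => (Function.update y.1 j y.2, y.1 j)
      invFun := fun y => (Function.update y.1 j y.2, y.1 j)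
      left_inv := fun y => by simp
      right_inv := fun y => by simp }
  refine (ENNReal.mul_le_mul_iff_right hX0 hXt).1 ?_
  calc (Fintype.card X : ℝ≥0∞) * ∑ Ω, Q Ω * b (Ω j)
      = ∑ y : (J → X) × X, Q y.1 * b (y.1 j) := by
        rw [Fintype.sum_prod_type, mul_sum]
        simp
    _ = ∑ y : (J → X) × X, Q (e y).1 * b ((e y).1 j) := (e.sum_comp fun y => Q y.1 * b (y.1 j)).symm
    _ = ∑ Ω, Q Ω * ∑ x, b x := by
        rw [Fintype.sum_prod_type]
        simp [e, hQ, mul_sum]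
    _ ≤ ∑ Ω, Q Ω * (p * Fintype.card X) := by gcongr
    _ = _ := by rw [← sum_mul]; ring

end PathLaw

/-! ### Draws with one column left out -/

namespace AdaptiveSampling

open Finset PathLaw
open scoped ENNReal

theorem sum_prod_ofReal_div {N : ℕ} (s : ℕ) {w : Fin N → ℝ} (hw : ∀ j, 0 ≤ w j)
    (h : ∑ j, w j ≠ 0) :
    ∑ d : Fin s → Fin N, ∏ i, ENNReal.ofReal (w (d i) / ∑ j, w j) = 1 := by
  have h1 := Finset.prod_univ_sum (fun _ : Fin s => (Finset.univ : Finset (Fin N)))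
    (fun _ j => ENNReal.ofReal (w j / ∑ j, w j))
  rw [Fintype.piFinset_univ] at h1
  rw [← h1, ← ENNReal.ofReal_sum_of_nonneg fun j _ => div_nonneg (hw j) (sum_nonneg fun j _ => hw j),
    ← sum_div, div_self h]
  simp

open Classical in
/-- The law of the set of `s` independent draws with probabilities proportional to `w`; if `w`
vanishes, nothing is drawn. -/
noncomputable def drawLaw {N : ℕ} (s : ℕ) (w : Fin N → ℝ) (hw : ∀ j, 0 ≤ w j) :
    PMF (Finset (Fin N)) :=
  if h : ∑ j, w j ≠ 0 then
    (PMF.ofFintype (fun d : Fin s → Fin N => ∏ i, ENNReal.ofReal (w (d i) / ∑ j, w j))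
      (sum_prod_ofReal_div s hw h)).map fun d => Finset.univ.image d
  else PMF.pure ∅

/-- For draws that avoid j, deleting the weight of j keeps every numerator and can only lower the
denominator. -/
theorem drawLaw_le_drawLaw_update {N : ℕ} (s : ℕ) {w : Fin N → ℝ} (hw : ∀ j, 0 ≤ w j) {j : Fin N}
    (hw' : ∀ i, 0 ≤ Function.update w j 0 i) {P : Finset (Fin N)} (hP : j ∉ P) :
    drawLaw s w hw P ≤ drawLaw s (Function.update w j 0) hw' P := by
  classical
  set w' := Function.update w j 0 with hw'def
  have hle : ∀ i, w' i ≤ w i := fun i => by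
    rcases eq_or_ne i j with rfl | hi
    · simpa [hw'def] using hw i
    · simp [hw'def, hi]
  have hne : ∀ i, i ≠ j → w' i = w i := fun i hi => by simp [hw'def, hi]
  have hsum : ∑ i, w' i ≤ ∑ i, w i := sum_le_sum fun i _ => hle i
  have hsum0 : 0 ≤ ∑ i, w' i := sum_nonneg fun i _ => hw' i
  by_cases h' : ∑ i, w' i = 0
  -- Here only j could have weight: the modified law is concentrated on ∅, and a non-empty P without
  -- j has probability zero under the original law.
  · have hzero : ∀ i, w' i = 0 := fun i =>
      (sum_eq_zero_iff_of_nonneg fun i _ => hw' i).1 h' i (mem_univ i)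
    have hd : drawLaw s w' hw' = PMF.pure ∅ := dif_neg (not_not.2 h')
    rw [hd]
    rcases eq_or_ne P ∅ with rfl | hPne
    · rw [PMF.pure_apply, if_pos rfl]
      exact PMF.coe_le_one _ _
    by_cases h : ∑ i, w i = 0
    · have hd : drawLaw s w hw = PMF.pure ∅ := dif_neg (not_not.2 h)
      rw [hd]
    · refine le_trans (le_of_eq ?_) zero_le
      rw [drawLaw, dif_pos h, PMF.map_apply, ENNReal.tsum_eq_zero]
      intro d
      split_ifs with hd
      · obtain ⟨a, ha⟩ := nonempty_iff_ne_empty.2 hPne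
        have ha' := ha
        rw [hd] at ha'
        obtain ⟨i, -, rfl⟩ := mem_image.1 ha'
        rw [PMF.ofFintype_apply]
        refine prod_eq_zero (mem_univ i) ?_
        have hij : d i ≠ j := fun hij => hP (hij ▸ ha)
        rw [← hne _ hij, hzero]
        simp
      · rfl
  · have hpos : 0 < ∑ i, w' i := lt_of_le_of_ne hsum0 (Ne.symm h')
    have h : ∑ i, w i ≠ 0 := (hpos.trans_le hsum).ne'
    rw [drawLaw, drawLaw, dif_pos h, dif_pos h', PMF.map_apply, PMF.map_apply]
    refine ENNReal.tsum_le_tsum fun d => ?_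
    split_ifs with hd
    · rw [PMF.ofFintype_apply, PMF.ofFintype_apply]
      refine prod_le_prod' fun i _ => ENNReal.ofReal_le_ofReal ?_
      have hij : d i ≠ j := fun hij => hP (by
        rw [hd, ← hij]; exact mem_image_of_mem _ (mem_univ i))
      change w (d i) / ∑ i, w i ≤ w' (d i) / ∑ i, w' i
      rw [hne _ hij]
      have := hw (d i)
      gcongr
    · exact le_rfl

variable {N₁ N₂ N₃ m : ℕ} [NeZero N₃]

theorem roundLaw_eq_drawLaw (T : Tensor N₁ N₂ N₃) (Ω : Fin N₂ → Fin m → Fin N₁) (s : ℕ)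
    (K : Submodule ℝ (Slice N₁ N₃)) :
    roundLaw T Ω s K = drawLaw s (fun j => sampledSq T K (Ω j) j)
      fun j => sampledSq_nonneg T K (Ω j) j := rfl

theorem secondPassLaw_eq_pathLaw (T : Tensor N₁ N₂ N₃) (Ω : Fin N₂ → Fin m → Fin N₁) (s : ℕ) :
    ∀ l, secondPassLaw T Ω s l = pathLaw (fun h => roundLaw T Ω s (estSubspace T h)) l
  | 0 => rfl
  | l + 1 => by rw [secondPassLaw, pathLaw, secondPassLaw_eq_pathLaw T Ω s l]

end AdaptiveSampling

/-! The tensor-column subspaces of the second pass -/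

namespace AdaptiveSampling

open Finset FiniteProb PathLaw Tensor
open scoped BigOperators ENNReal InnerProductSpace

variable {N₁ N₂ N₃ m : ℕ} [NeZero N₃]

theorem circConv_assoc (a b c : ZMod N₃ → ℝ) :
    circConv (circConv a b) c = circConv a (circConv b c) := by
  funext n
  simp only [circConv, sum_mul, mul_sum]
  rw [sum_comm]
  refine sum_congr rfl fun p _ => ?_
  rw [← Equiv.sum_comp (Equiv.addRight p)]
  refine sum_congr rfl fun q _ => ?_
  simp only [Equiv.coe_addRight, add_sub_cancel_right]
  rw [show n - (q + p) = n - p - q by ring]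
  ring

theorem sliceMul_single (x : Slice N₁ N₃) : sliceMul x (Pi.single 0 1) = x := by
  ext p
  change ∑ l, x (p.1, l) * (Pi.single 0 1 : ZMod N₃ → ℝ) (p.2 - l) = x p
  rw [sum_eq_single p.2]
  · simp
  · intro l _ hl
    rw [Pi.single_eq_of_ne (sub_ne_zero.2 hl.symm), mul_zero]
  · simp

theorem sliceMul_sliceMul (x : Slice N₁ N₃) (c d : ZMod N₃ → ℝ) :
    sliceMul (sliceMul x c) d = sliceMul x (circConv c d) := by
  ext p
  exact congrFun (circConv_assoc (fun l => x (p.1, l)) c d) p.2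

theorem sliceMul_add (x y : Slice N₁ N₃) (c : ZMod N₃ → ℝ) :
    sliceMul (x + y) c = sliceMul x c + sliceMul y c := by
  ext p
  simp [sliceMul, circConv, add_mul, sum_add_distrib]

theorem sliceMul_smul (a : ℝ) (x : Slice N₁ N₃) (c : ZMod N₃ → ℝ) :
    sliceMul (a • x) c = a • sliceMul x c := by
  ext p
  simp [sliceMul, circConv, mul_sum, mul_assoc]

theorem sliceMul_zero (c : ZMod N₃ → ℝ) : sliceMul (0 : Slice N₁ N₃) c = 0 := by
  ext p
  simp [sliceMul, circConv]

theorem mem_tSpan {A : Set (Slice N₁ N₃)} {x : Slice N₁ N₃} (hx : x ∈ A) : x ∈ tSpan A :=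
  Submodule.subset_span ⟨x, hx, Pi.single 0 1, (sliceMul_single x).symm⟩

theorem sliceMul_mem_tSpan {A : Set (Slice N₁ N₃)} {y : Slice N₁ N₃} (hy : y ∈ tSpan A)
    (c : ZMod N₃ → ℝ) : sliceMul y c ∈ tSpan A := by
  induction hy using Submodule.span_induction with
  | mem y hy =>
    obtain ⟨x, hx, d, rfl⟩ := hy
    exact Submodule.subset_span ⟨x, hx, circConv d c, sliceMul_sliceMul x d c⟩
  | zero => rw [sliceMul_zero]; exact Submodule.zero_mem _
  | add y z _ _ h1 h2 => rw [sliceMul_add]; exact Submodule.add_mem _ h1 h2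
  | smul a y _ h => rw [sliceMul_smul]; exact Submodule.smul_mem _ _ h

theorem sliceMul_mem_estSubspace (T : Tensor N₁ N₂ N₃) (c : ZMod N₃ → ℝ) :
    ∀ (h : List (Finset (Fin N₂))) {x : Slice N₁ N₃}, x ∈ estSubspace T h →
      sliceMul x c ∈ estSubspace T h
  | [], x, hx => by
    rw [(Submodule.mem_bot ℝ).1 hx, sliceMul_zero]
    exact Submodule.zero_mem _
  | P :: h, x, hx => by
    obtain ⟨y, hy, z, hz, rfl⟩ := Submodule.mem_sup.1 hx
    rw [sliceMul_add]
    exact Submodule.add_mem_sup (sliceMul_mem_estSubspace T c h hy) (sliceMul_mem_tSpan hz c)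

theorem blk_mem_of_mem_estSubspace {T : Tensor N₁ N₂ N₃}
    {W : ZMod N₃ → Submodule ℂ (EuclideanSpace ℂ (Fin N₁))}
    (hT : ∀ j k, blk k (lateral T j) ∈ W k) :
    ∀ (h : List (Finset (Fin N₂))) {x : Slice N₁ N₃}, x ∈ estSubspace T h → ∀ k, blk k x ∈ W k
  | [], x, hx, k => by
    rw [(Submodule.mem_bot ℝ).1 hx, map_zero]
    exact Submodule.zero_mem _
  | P :: h, x, hx, k => by
    obtain ⟨y, hy, z, hz, rfl⟩ := Submodule.mem_sup.1 hx
    rw [map_add]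
    refine Submodule.add_mem _ (blk_mem_of_mem_estSubspace hT h hy k) ?_
    clear hx hy
    have hres : ∀ j, blk k (residual T (estSubspace T h) j) ∈ W k := fun j => by
      rw [residual_eq_sub, map_sub]
      exact Submodule.sub_mem _ (hT j k)
        (blk_mem_of_mem_estSubspace hT h (Submodule.starProjection_apply_mem _ _) k)
    induction hz using Submodule.span_induction with
    | mem y hy =>
      obtain ⟨_, ⟨j, -, rfl⟩, c, rfl⟩ := hy
      rw [blk_sliceMul, map_smul]
      exact Submodule.smul_mem _ _ ((W k).smul_of_tower_mem _ (hres j))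
    | zero => rw [map_zero]; exact Submodule.zero_mem _
    | add y z _ _ h1 h2 => rw [map_add]; exact Submodule.add_mem _ h1 h2
    | smul a y _ h => rw [map_smul]; exact (W k).smul_of_tower_mem _ h

theorem residual_eq_zero {T : Tensor N₁ N₂ N₃} {K : Submodule ℝ (Slice N₁ N₃)} {j : Fin N₂}
    (h : lateral T j ∈ K) : residual T K j = 0 :=
  Submodule.starProjection_orthogonal_apply_eq_zero h

theorem sampledSq_eq_zero {T : Tensor N₁ N₂ N₃} {K : Submodule ℝ (Slice N₁ N₃)} {j : Fin N₂}
    (h : lateral T j ∈ K) (ω : Fin m → Fin N₁) : sampledSq T K ω j = 0 := by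
  refine le_antisymm ?_ (sampledSq_nonneg T K ω j)
  simpa [residual_eq_zero h] using sampledSq_le T K ω j

theorem estSubspace_le_cons (T : Tensor N₁ N₂ N₃) (P : Finset (Fin N₂))
    (h : List (Finset (Fin N₂))) : estSubspace T h ≤ estSubspace T (P :: h) := le_sup_left

theorem lateral_mem_estSubspace_cons (T : Tensor N₁ N₂ N₃) {P : Finset (Fin N₂)}
    (h : List (Finset (Fin N₂))) {j : Fin N₂} (hj : j ∈ P) :
    lateral T j ∈ estSubspace T (P :: h) := by
  have h1 : lateral T j = residual T (estSubspace T h) j +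
      (estSubspace T h).starProjection (lateral T j) := by
    rw [residual_eq_sub, sub_add_cancel]
  rw [h1]
  refine Submodule.add_mem _ ?_
    (estSubspace_le_cons T P h (Submodule.starProjection_apply_mem _ _))
  set c := √(∑ j' ∈ P, ‖residual T (estSubspace T h) j'‖ ^ 2) with hc
  have h2 : c⁻¹ • residual T (estSubspace T h) j ∈ estSubspace T (P :: h) :=
    Submodule.mem_sup_right (mem_tSpan ⟨j, hj, rfl⟩)
  rcases eq_or_ne c 0 with h0 | h0
  · rw [hc, Real.sqrt_eq_zero (sum_nonneg fun _ _ => sq_nonneg _),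
      sum_eq_zero_iff_of_nonneg fun _ _ => sq_nonneg _] at h0
    rw [norm_eq_zero.1 (pow_eq_zero_iff two_ne_zero |>.1 (h0 j hj))]
    exact Submodule.zero_mem _
  · have := Submodule.smul_mem _ c h2
    rwa [smul_inv_smul₀ h0] at this

theorem lateral_mem_estSubspace (T : Tensor N₁ N₂ N₃) {j : Fin N₂} {P : Finset (Fin N₂)}
    (hj : j ∈ P) : ∀ {h : List (Finset (Fin N₂))}, P ∈ h → lateral T j ∈ estSubspace T h
  | Q :: h, hP => by
    rcases List.mem_cons.1 hP with rfl | hP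
    · exact lateral_mem_estSubspace_cons T h hj
    · exact estSubspace_le_cons T Q h (lateral_mem_estSubspace T hj hP)

open Classical in
/-- The number of columns in the subspace reached after a history. -/
noncomputable def capturedCount (T : Tensor N₁ N₂ N₃) (h : List (Finset (Fin N₂))) : ℕ :=
  (univ.filter fun j => lateral T j ∈ estSubspace T h).card

theorem capturedCount_le_cons (T : Tensor N₁ N₂ N₃) (P : Finset (Fin N₂))
    (h : List (Finset (Fin N₂))) : capturedCount T h ≤ capturedCount T (P :: h) := by
  classical
  exact card_le_card fun j hj => mem_filter.2
    ⟨mem_univ j, estSubspace_le_cons T P h (mem_filter.1 hj).2⟩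

theorem capturedCount_le (T : Tensor N₁ N₂ N₃) (h : List (Finset (Fin N₂))) :
    capturedCount T h ≤ N₂ := by
  classical
  exact (card_filter_le _ _).trans (by simp)

/-- If no column was newly captured, all selected columns were captured before, so their residuals
vanish and nothing is appended. -/
theorem estSubspace_cons_eq (T : Tensor N₁ N₂ N₃) {P : Finset (Fin N₂)}
    {h : List (Finset (Fin N₂))} (hc : capturedCount T (P :: h) = capturedCount T h) :
    estSubspace T (P :: h) = estSubspace T h := by
  classical
  have hsub : (univ.filter fun j => lateral T j ∈ estSubspace T h) ⊆
      univ.filter fun j => lateral T j ∈ estSubspace T (P :: h) := fun j hj =>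
    mem_filter.2 ⟨mem_univ j, estSubspace_le_cons T P h (mem_filter.1 hj).2⟩
  have heq := eq_of_subset_of_card_le hsub hc.le
  refine le_antisymm (sup_le le_rfl (Submodule.span_le.2 ?_)) (estSubspace_le_cons T P h)
  rintro _ ⟨_, ⟨j, hj, rfl⟩, c, rfl⟩
  have h1 : lateral T j ∈ estSubspace T h := by
    have : j ∈ univ.filter fun j => lateral T j ∈ estSubspace T (P :: h) :=
      mem_filter.2 ⟨mem_univ j, lateral_mem_estSubspace_cons T h hj⟩
    rw [← heq] at this
    exact (mem_filter.1 this).2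
  rw [residual_eq_zero h1, smul_zero, sliceMul_zero]
  exact Submodule.zero_mem _

/-- The sampled residual energy of column `j` is within the factors `1/2` and `5/4` of its mean. -/
def IsAccurate (T : Tensor N₁ N₂ N₃) (K : Submodule ℝ (Slice N₁ N₃)) (j : Fin N₂)
    (ω : Fin m → Fin N₁) : Prop :=
  1 / 2 * (m / N₁) * ‖residual T K j‖ ^ 2 ≤ sampledSq T K ω j ∧
    sampledSq T K ω j ≤ 5 / 4 * (m / N₁) * ‖residual T K j‖ ^ 2

theorem isAccurate_of_lateral_mem {T : Tensor N₁ N₂ N₃} {K : Submodule ℝ (Slice N₁ N₃)}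
    {j : Fin N₂} (h : lateral T j ∈ K) (ω : Fin m → Fin N₁) : IsAccurate T K j ω := by
  simp [IsAccurate, sampledSq_eq_zero h, residual_eq_zero h]

/-- The common factor m/N₁ cancels in the quotient, and (1/2)/(5/4) = 2/5. -/
theorem ratio_bounds {T : Tensor N₁ N₂ N₃} {Ω : Fin N₂ → Fin m → Fin N₁}
    {K : Submodule ℝ (Slice N₁ N₃)} [NeZero N₁] (hm : 0 < m)
    (h : ∀ j, IsAccurate T K j (Ω j)) (hK : residualSq T K ≠ 0) (j : Fin N₂) :
    2 / 5 * trueProb T K j ≤ estProb T Ω K j ∧ estProb T Ω K j ≤ 5 / 2 * trueProb T K j := by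
  have hN₁ : (0 : ℝ) < N₁ := by exact_mod_cast Nat.pos_of_ne_zero (NeZero.ne N₁)
  have hm' : (0 : ℝ) < m := by exact_mod_cast hm
  have hR : 0 < residualSq T K := lt_of_le_of_ne (sum_nonneg fun _ _ => sq_nonneg _) (Ne.symm hK)
  set c : ℝ := m / N₁ with hc
  have hc0 : 0 < c := by positivity
  have hlow : 1 / 2 * c * residualSq T K ≤ ∑ j, sampledSq T K (Ω j) j := by
    rw [residualSq, mul_sum]
    exact sum_le_sum fun j _ => (h j).1
  have hup : ∑ j, sampledSq T K (Ω j) j ≤ 5 / 4 * c * residualSq T K := by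
    rw [residualSq, mul_sum]
    exact sum_le_sum fun j _ => (h j).2
  have hpos : 0 < ∑ j, sampledSq T K (Ω j) j := lt_of_lt_of_le (by positivity) hlow
  have hj := h j
  rw [IsAccurate, ← hc] at hj
  have he : 0 ≤ ‖residual T K j‖ ^ 2 := sq_nonneg _
  rw [trueProb, estProb]
  set e := ‖residual T K j‖ ^ 2
  set R := residualSq T K
  set S := ∑ j, sampledSq T K (Ω j) j
  constructor
  · rw [← mul_div_assoc, div_le_div_iff₀ hR hpos]
    calc 2 / 5 * e * S ≤ 2 / 5 * e * (5 / 4 * c * R) := by gcongr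
      _ = 1 / 2 * c * e * R := by ring
      _ ≤ _ := by gcongr; exact hj.1
  · rw [← mul_div_assoc, div_le_div_iff₀ hpos hR]
    calc _ ≤ 5 / 4 * c * e * R := by gcongr; exact hj.2
      _ = 5 / 2 * e * (1 / 2 * c * R) := by ring
      _ ≤ _ := by gcongr

/-! Decoupling the second pass from the first-pass samples of one column -/

/-- The weights of a round with column `j` left out. -/
noncomputable def leaveOutWeights (T : Tensor N₁ N₂ N₃) (Ω : Fin N₂ → Fin m → Fin N₁) (j : Fin N₂)
    (K : Submodule ℝ (Slice N₁ N₃)) : Fin N₂ → ℝ :=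
  Function.update (fun i => sampledSq T K (Ω i) i) j 0

theorem leaveOutWeights_nonneg (T : Tensor N₁ N₂ N₃) (Ω : Fin N₂ → Fin m → Fin N₁) (j : Fin N₂)
    (K : Submodule ℝ (Slice N₁ N₃)) (i : Fin N₂) : 0 ≤ leaveOutWeights T Ω j K i := by
  rcases eq_or_ne i j with rfl | hi
  · simp [leaveOutWeights]
  · simpa [leaveOutWeights, hi] using sampledSq_nonneg T K (Ω i) i

/-- The kernel of a second pass that ignores column `j`. -/
noncomputable def leaveOutKernel (T : Tensor N₁ N₂ N₃) (Ω : Fin N₂ → Fin m → Fin N₁) (s : ℕ)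
    (j : Fin N₂) (h : List (Finset (Fin N₂))) : PMF (Finset (Fin N₂)) :=
  drawLaw s (leaveOutWeights T Ω j (estSubspace T h))
    (leaveOutWeights_nonneg T Ω j (estSubspace T h))

theorem leaveOutKernel_update (T : Tensor N₁ N₂ N₃) (Ω : Fin N₂ → Fin m → Fin N₁) (s : ℕ)
    (j : Fin N₂) (ω : Fin m → Fin N₁) :
    leaveOutKernel T (Function.update Ω j ω) s j = leaveOutKernel T Ω s j := by
  funext h
  have hw : leaveOutWeights T (Function.update Ω j ω) j (estSubspace T h) =
      leaveOutWeights T Ω j (estSubspace T h) := by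
    funext i
    rcases eq_or_ne i j with rfl | hi
    · simp [leaveOutWeights]
    · simp [leaveOutWeights, hi]
  simp only [leaveOutKernel, hw]

theorem sum_ite_eq_ofReal_pr {X : Type*} [Fintype X] [Nonempty X] (b : X → Prop)
    [DecidablePred b] :
    ∑ x, (if b x then (1 : ℝ≥0∞) else 0) = ENNReal.ofReal (pr b) * Fintype.card X := by
  have h1 : pr b * Fintype.card X = ((univ.filter b).card : ℝ) := by
    rw [pr, Fintype.expect_eq_sum_div_card, div_mul_cancel₀ _ (by simp), Finset.card_filter]
    push_cast
    refine sum_congr rfl fun x _ => ?_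
    by_cases hx : b x <;> simp [hx]
  rw [← ENNReal.ofReal_natCast (Fintype.card X), ← ENNReal.ofReal_mul (pr_nonneg b), h1, sum_boole]
  simp

theorem toOuterMeasure_twoPassLaw [NeZero N₁] (T : Tensor N₁ N₂ N₃) (s L : ℕ)
    (E : Set ((Fin N₂ → Fin m → Fin N₁) × List (Finset (Fin N₂)))) :
    (twoPassLaw T m s L).toOuterMeasure E =
      ∑ Ω, (Fintype.card (Fin N₂ → Fin m → Fin N₁) : ℝ≥0∞)⁻¹ *
        (secondPassLaw T Ω s L).toOuterMeasure {h | (Ω, h) ∈ E} := by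
  rw [toOuterMeasure_eq_tsum_mul, twoPassLaw, tsum_bind_mul, tsum_fintype]
  refine sum_congr rfl fun Ω _ => ?_
  rw [tsum_map_mul, toOuterMeasure_eq_tsum_mul, PMF.uniformOfFintype_apply]
  rfl

/-- The fixed-subspace bound p survives adaptivity at the price of a factor N₂ + 1: the true process
is dominated by the one that leaves out j, and only new histories are counted. -/
theorem toOuterMeasure_not_isAccurate_le [NeZero N₁] (T : Tensor N₁ N₂ N₃) (s L : ℕ) (j : Fin N₂)
    {p : ℝ} (hp : ∀ h : List (Finset (Fin N₂)),
      pr (fun ω : Fin m → Fin N₁ => ¬ IsAccurate T (estSubspace T h) j ω) ≤ p) :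
    (twoPassLaw T m s L).toOuterMeasure
      {x | ∃ h, h <:+ x.2 ∧ ¬ IsAccurate T (estSubspace T h) j (x.1 j)} ≤
        ENNReal.ofReal p * (N₂ + 1) := by
  classical
  set c : ℝ≥0∞ := (Fintype.card (Fin N₂ → Fin m → Fin N₁) : ℝ≥0∞) with hc
  have hc0 : c ≠ 0 := by simp [hc, NeZero.ne]
  have hct : c ≠ ∞ := by simp [hc]
  let New : Set (List (Finset (Fin N₂))) := {h | IsNew (capturedCount T) h}
  let b : List (Finset (Fin N₂)) → (Fin m → Fin N₁) → ℝ≥0∞ := fun h ω =>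
    if ¬ IsAccurate T (estSubspace T h) j ω then 1 else 0
  have hb : ∀ h, ∑ ω, b h ω ≤ ENNReal.ofReal p * Fintype.card (Fin m → Fin N₁) := fun h => by
    simp only [b]
    rw [sum_ite_eq_ofReal_pr fun ω => ¬ IsAccurate T (estSubspace T h) j ω]
    gcongr
    exact hp h
  have hκ : ∀ (Ω : Fin N₂ → Fin m → Fin N₁) h P, j ∉ P →
      roundLaw T Ω s (estSubspace T h) P ≤ leaveOutKernel T Ω s j h P := fun Ω h P hP => by
    rw [roundLaw_eq_drawLaw]
    exact drawLaw_le_drawLaw_update s _ _ hP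
  have hstep : ∀ Ω, (secondPassLaw T Ω s L).toOuterMeasure
      {h' | ∃ h, h <:+ h' ∧ ¬ IsAccurate T (estSubspace T h) j (Ω j)} ≤
      ∑ l ∈ range (L + 1), ∑' h, pathLaw (leaveOutKernel T Ω s j) l h * New.indicator 1 h *
        b h (Ω j) := by
    intro Ω
    rw [secondPassLaw_eq_pathLaw]
    let B : Set (List (Finset (Fin N₂))) := {h | (∀ P ∈ h, j ∉ P) ∧ h ∈ New ∧
      ¬ IsAccurate T (estSubspace T h) j (Ω j)}
    have hsub : {h' | ∃ h, h <:+ h' ∧ ¬ IsAccurate T (estSubspace T h) j (Ω j)} ⊆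
        {h' | ∃ h, h <:+ h' ∧ h ∈ B} := by
      rintro h' ⟨h, hs, hbad⟩
      obtain ⟨h'', hs', hnew, hbad'⟩ := exists_isNew_suffix (c := capturedCount T)
        (B := fun h => ¬ IsAccurate T (estSubspace T h) j (Ω j)) (capturedCount_le_cons T)
        (fun P h hcount hB => by rwa [estSubspace_cons_eq T hcount] at hB) h hbad
      -- Once j has been selected it is captured and trivially accurate, so a failing history never
      -- contains j.
      refine ⟨h'', hs'.trans hs, fun P hP hj => hbad' ?_, hnew, hbad'⟩
      exact isAccurate_of_lateral_mem (lateral_mem_estSubspace T hj hP) _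
    refine ((MeasureTheory.measure_mono hsub).trans
      (toOuterMeasure_exists_suffix_le _ B L)).trans ?_
    refine sum_le_sum fun l _ => ?_
    rw [toOuterMeasure_eq_tsum_mul]
    refine ENNReal.tsum_le_tsum fun h => ?_
    by_cases hB : h ∈ B
    · rw [Set.indicator_of_mem hB, Set.indicator_of_mem hB.2.1]
      simp only [b, if_pos hB.2.2, Pi.one_apply, mul_one]
      exact pathLaw_le_pathLaw (hκ Ω) l h hB.1
    · rw [Set.indicator_of_notMem hB, mul_zero]
      exact zero_le
  rw [toOuterMeasure_twoPassLaw, ← hc, ← mul_sum]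
  calc c⁻¹ * ∑ Ω, (secondPassLaw T Ω s L).toOuterMeasure
        {h' | ∃ h, h <:+ h' ∧ ¬ IsAccurate T (estSubspace T h) j (Ω j)}
      ≤ c⁻¹ * ∑ Ω, ∑ l ∈ range (L + 1), ∑' h, pathLaw (leaveOutKernel T Ω s j) l h *
          New.indicator 1 h * b h (Ω j) := by
        gcongr with Ω; exact hstep Ω
    _ = c⁻¹ * ∑ l ∈ range (L + 1), ∑' h, ∑ Ω, pathLaw (leaveOutKernel T Ω s j) l h *
          New.indicator 1 h * b h (Ω j) := by
        rw [sum_comm]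
        congr 1
        refine sum_congr rfl fun l _ => ?_
        rw [Summable.tsum_finsetSum fun _ _ => ENNReal.summable]
    _ ≤ c⁻¹ * ∑ l ∈ range (L + 1), ∑' h, ENNReal.ofReal p *
          ∑ Ω : Fin N₂ → Fin m → Fin N₁, pathLaw (leaveOutKernel T Ω s j) l h *
            New.indicator 1 h := by
        gcongr with l _ h
        -- For a fixed history the weight ignores the samples of column j, so these can be averaged
        -- out.
        exact sum_mul_coordinate_le (fun Ω ω => by rw [leaveOutKernel_update]) (hb h)
    _ = ENNReal.ofReal p * (c⁻¹ * ∑ Ω : Fin N₂ → Fin m → Fin N₁, ∑ l ∈ range (L + 1),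
          (pathLaw (leaveOutKernel T Ω s j) l).toOuterMeasure New) := by
        rw [mul_left_comm (ENNReal.ofReal p), sum_comm, mul_sum _ _ (ENNReal.ofReal p)]
        congr 1
        refine sum_congr rfl fun l _ => ?_
        rw [ENNReal.tsum_mul_left, Summable.tsum_finsetSum fun _ _ => ENNReal.summable]
        simp only [toOuterMeasure_eq_tsum_mul]
    _ ≤ ENNReal.ofReal p * (c⁻¹ * ∑ _Ω : Fin N₂ → Fin m → Fin N₁, ((N₂ : ℝ≥0∞) + 1)) := by
        gcongr with Ω
        exact sum_toOuterMeasure_isNew_le _ (capturedCount_le_cons T) (capturedCount_le T) L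
    _ = _ := by
        rw [sum_const, card_univ, nsmul_eq_mul, ← hc, ENNReal.inv_mul_cancel_left hc0 hct]

end AdaptiveSampling

/-! The sampling budget -/

namespace AdaptiveSampling

open Finset FiniteProb PathLaw Tensor
open scoped BigOperators ENNReal InnerProductSpace

theorem failure_le {r N : ℕ} {ρ ν : ℝ} {G : ℕ} (hN : 1 ≤ N) (hr : r ≤ N) (hρ : 0 < ρ)
    (hρ' : ρ < 1 / 6) (hG : 80 * Real.log (N / ρ) ≤ G)
    (hν : 11 * Real.log (N / ρ) ≤ ν / (1600 * G)) (hν' : 2 * Real.log (N / ρ) ≤ ν / 64) :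
    4 * (4 * (r * Real.exp (-(ν / (1600 * G)))) + Real.exp (-(G / 20))) +
      Real.exp (-(ν / 64)) ≤ 3 * (ρ / N) ^ 2 := by
  have hN' : (1 : ℝ) ≤ N := by exact_mod_cast hN
  have hN0 : (0 : ℝ) < N := by linarith
  set q := ρ / N with hq
  have hq0 : 0 < q := by positivity
  have hq6 : q ≤ 1 / 6 := by
    rw [hq, div_le_iff₀ hN0]; linarith
  have hpow : ∀ n : ℕ, Real.exp (-(n * Real.log (N / ρ))) = q ^ n := fun n => by
    rw [← mul_neg, ← Real.log_inv, inv_div, Real.exp_nat_mul, Real.exp_log hq0]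
  -- One of the eleven factors q = ρ/N pays for the dimension r ≤ N.
  have h1 : Real.exp (-(ν / (1600 * G))) ≤ q ^ 11 := by
    rw [← hpow]; exact Real.exp_le_exp.2 (neg_le_neg (by exact_mod_cast hν))
  have h2 : Real.exp (-(G / 20)) ≤ q ^ 4 := by
    rw [← hpow]
    refine Real.exp_le_exp.2 (neg_le_neg ?_)
    push_cast; linarith
  have h3 : Real.exp (-(ν / 64)) ≤ q ^ 2 := by
    rw [← hpow]; exact Real.exp_le_exp.2 (neg_le_neg (by exact_mod_cast hν'))
  have hrq : r * q ≤ 1 := by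
    have : (r : ℝ) ≤ N := by exact_mod_cast hr
    calc r * q ≤ N * q := by gcongr
      _ = ρ := by rw [hq]; field_simp
      _ ≤ 1 := by linarith
  have h4 : r * Real.exp (-(ν / (1600 * G))) ≤ q ^ 10 := by
    calc r * Real.exp (-(ν / (1600 * G))) ≤ r * q ^ 11 := by gcongr
      _ = (r * q) * q ^ 10 := by ring
      _ ≤ 1 * q ^ 10 := by gcongr
      _ = q ^ 10 := one_mul _
  have h5 : q ^ 2 ≤ (1 / 6) ^ 2 := pow_le_pow_left₀ hq0.le hq6 2
  have h6 : q ^ 8 ≤ (1 / 6) ^ 8 := pow_le_pow_left₀ hq0.le hq6 8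
  have h7 : 16 * q ^ 10 ≤ q ^ 2 := by
    calc 16 * q ^ 10 = 16 * q ^ 8 * q ^ 2 := by ring
      _ ≤ 16 * (1 / 6) ^ 8 * q ^ 2 := by gcongr
      _ ≤ 1 * q ^ 2 := by gcongr; norm_num
      _ = q ^ 2 := one_mul _
  have h8 : 4 * q ^ 4 ≤ q ^ 2 := by
    calc 4 * q ^ 4 = 4 * q ^ 2 * q ^ 2 := by ring
      _ ≤ 4 * (1 / 6) ^ 2 * q ^ 2 := by gcongr
      _ ≤ 1 * q ^ 2 := by gcongr; norm_num
      _ = q ^ 2 := one_mul _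
  linarith

theorem budget_le {C μ₀ ρ ε : ℝ} (hC : 0 < C) (hμ : 0 < μ₀) (hρ : 0 < ρ) (hρ' : ρ < 1)
    (hε : 0 < ε) :
    ∃ K : ℝ, 0 < K ∧ ∀ N₁ N₂ N₃ r : ℕ, 1 ≤ N₁ → 1 ≤ N₂ → 1 ≤ N₃ →
      2 ≤ max N₁ N₂ → N₃ ≤ max N₁ N₂ → r ≤ min N₁ N₂ →
      budget C N₁ N₂ N₃ r μ₀ ρ ε ≤
        K * ((max N₁ N₂ : ℕ) * r * Real.log (max N₁ N₂ : ℕ) ^ 2) := by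
  set a := -Real.log ρ with ha
  have ha0 : 0 < a := neg_pos.2 (Real.log_neg hρ hρ')
  refine ⟨C * (μ₀ * (1 + 2 * a) * (2 + 2 * a) + 25 / (ρ * ε)), by positivity, ?_⟩
  intro N₁ N₂ N₃ r h1 h2 h3 hmax h3max hr
  rcases Nat.eq_zero_or_pos r with rfl | hr0
  · simp [budget]
  set N := max N₁ N₂ with hN
  have hle₁ : (N₁ : ℝ) ≤ N := by exact_mod_cast le_max_left _ _
  have hle₂ : (N₂ : ℝ) ≤ N := by exact_mod_cast le_max_right _ _
  have hle₃ : (N₃ : ℝ) ≤ N := by exact_mod_cast h3max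
  have hler : (r : ℝ) ≤ N := by
    exact_mod_cast (hr.trans (min_le_left _ _)).trans (le_max_left _ _)
  have h1' : (1 : ℝ) ≤ N₁ := by exact_mod_cast h1
  have h2' : (1 : ℝ) ≤ N₂ := by exact_mod_cast h2
  have h3' : (1 : ℝ) ≤ N₃ := by exact_mod_cast h3
  have hr' : (1 : ℝ) ≤ r := by exact_mod_cast hr0
  -- This lets log N absorb additive constants: a ≤ 2a log N, and rounding up gives 3 log N + 1 ≤ 5
  -- log N.
  have hl : 1 / 2 ≤ Real.log N := by
    have h4 : Real.log 2 ≤ Real.log N := Real.log_le_log (by norm_num) (by exact_mod_cast hmax)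
    have := Real.log_two_gt_d9
    linarith
  have hlog : ∀ x : ℝ, 1 ≤ x → x ≤ N → 0 ≤ Real.log x ∧ Real.log x ≤ Real.log N := fun x hx hxN =>
    ⟨Real.log_nonneg hx, Real.log_le_log (by linarith) hxN⟩
  have hA : Real.log (N₂ / ρ) = Real.log N₂ + a := by
    rw [Real.log_div (by positivity) hρ.ne', ha, sub_eq_add_neg]
  have hB : Real.log (r * N₂ / ρ) = Real.log r + Real.log N₂ + a := by
    rw [Real.log_div (by positivity) hρ.ne', Real.log_mul (by positivity) (by positivity), ha,
      sub_eq_add_neg]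
  have hD : Real.log ((N₁ : ℝ) * N₂ * N₃) = Real.log N₁ + Real.log N₂ + Real.log N₃ := by
    rw [Real.log_mul (by positivity) (by positivity), Real.log_mul (by positivity) (by positivity)]
  obtain ⟨p1, q1⟩ := hlog _ h1' hle₁
  obtain ⟨p2, q2⟩ := hlog _ h2' hle₂
  obtain ⟨p3, q3⟩ := hlog _ h3' hle₃
  obtain ⟨pr, qr⟩ := hlog _ hr' hler
  set l := Real.log N
  have hceil : (⌈Real.log ((N₁ : ℝ) * N₂ * N₃)⌉ : ℝ) ≤ 5 * l := by
    have := (Int.ceil_lt_add_one (Real.log ((N₁ : ℝ) * N₂ * N₃))).le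
    rw [hD] at this ⊢
    linarith
  have hceil0 : 0 ≤ (⌈Real.log ((N₁ : ℝ) * N₂ * N₃)⌉ : ℝ) := by
    have := Int.le_ceil (Real.log ((N₁ : ℝ) * N₂ * N₃))
    rw [hD] at this ⊢
    linarith
  have hA' : Real.log (N₂ / ρ) ≤ (1 + 2 * a) * l := by rw [hA]; nlinarith
  have hB' : Real.log (r * N₂ / ρ) ≤ (2 + 2 * a) * l := by rw [hB]; nlinarith
  have hB0 : 0 ≤ Real.log (r * N₂ / ρ) := by rw [hB]; linarith
  have hA0 : 0 ≤ Real.log (N₂ / ρ) := by rw [hA]; linarith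
  rw [budget]
  calc _ ≤ C * r * N * (μ₀ * ((1 + 2 * a) * l) * ((2 + 2 * a) * l) + (5 * l) ^ 2 / (ρ * ε)) := by
        gcongr
    _ = _ := by ring

end AdaptiveSampling

/-! ### Choice of constants and conclusion -/

open Tensor AdaptiveSampling FiniteProb in
theorem AdaptiveSampling.ofReal_le_toOuterMeasure_algorithmLaw {δ : ℝ} (hδ₀ : 0 < δ)
    {N₁ N₂ N₃ : ℕ} [NeZero N₁] [NeZero N₂] [NeZero N₃]
    {T : Tensor N₁ N₂ N₃} {U : Tensor N₁ N₁ N₃} {Θ : Tensor N₁ N₂ N₃} {V : Tensor N₂ N₂ N₃}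
    {r : ℕ} {μ₀ ρ ε M : ℝ} (L : ℕ) (hT : IsTSVD T U Θ V) (hr : numNonzeroTubes Θ = r)
    (hμ : coherence U r ≤ μ₀) (hρ : 0 < ρ) (hε : 0 < ε)
    (hM : budget (2000000 / δ) N₁ N₂ N₃ r μ₀ ρ ε ≤ M) :
    ENNReal.ofReal (1 - 6 * ρ) ≤ (algorithmLaw T M δ L).toOuterMeasure
      {x | ∀ h : List (Finset (Fin N₂)), h <:+ x.2 → residualSq T (estSubspace T h) ≠ 0 →
        ∀ j : Fin N₂, 2 / 5 * trueProb T (estSubspace T h) j ≤ estProb T x.1 (estSubspace T h) j ∧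
          estProb T x.1 (estSubspace T h) j ≤ 5 / 2 * trueProb T (estSubspace T h) j} := by
  have hN₁ : 1 ≤ N₁ := Nat.pos_of_ne_zero (NeZero.ne N₁)
  have hN₂ : 1 ≤ N₂ := Nat.pos_of_ne_zero (NeZero.ne N₂)
  have hN₁' : (1 : ℝ) ≤ N₁ := by exact_mod_cast hN₁
  have hN₂' : (1 : ℝ) ≤ N₂ := by exact_mod_cast hN₂
  have hN₃' : (0 : ℝ) < N₃ := by exact_mod_cast Nat.pos_of_ne_zero (NeZero.ne N₃)
  -- For ρ ≥ 1/6 the claimed probability is not positive.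
  rcases le_or_gt (1 / 6) ρ with hρ' | hρ'
  · rw [ENNReal.ofReal_of_nonpos (by linarith)]
    exact zero_le
  have hcol : ∀ j k, blk k (lateral T j) ∈ colSpace U r k := fun j k =>
    hr ▸ blk_lateral_mem_colSpace hT j k
  rcases Nat.eq_zero_or_pos r with hr0 | hr0
  · have hzero : ∀ K : Submodule ℝ (Slice N₁ N₃), residualSq T K = 0 := by
      intro K
      refine Finset.sum_eq_zero fun j _ => ?_
      have h1 : lateral T j = 0 := by
        have h2 := sum_norm_blk_sq (lateral T j)
        have h3 : ∀ k, blk k (lateral T j) = 0 := fun k => by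
          have := hcol j k
          rw [colSpace, hr0] at this
          simpa using this
        simp only [h3, norm_zero] at h2
        have h4 : ‖lateral T j‖ ^ 2 = 0 := by
          simpa [hN₃'.ne'] using h2.symm
        exact norm_eq_zero.1 (pow_eq_zero_iff two_ne_zero |>.1 h4)
      rw [residual_eq_zero (h1 ▸ K.zero_mem)]
      simp
    have huniv : {x : (Fin N₂ → Fin ⌊δ * M / N₂⌋₊ → Fin N₁) × List (Finset (Fin N₂)) |
        ∀ h : List (Finset (Fin N₂)), h <:+ x.2 → residualSq T (estSubspace T h) ≠ 0 →
        ∀ j : Fin N₂, 2 / 5 * trueProb T (estSubspace T h) j ≤ estProb T x.1 (estSubspace T h) j ∧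
          estProb T x.1 (estSubspace T h) j ≤ 5 / 2 * trueProb T (estSubspace T h) j} =
        Set.univ := by
      refine Set.eq_univ_of_forall fun x h _ hne => absurd (hzero _) hne
    rw [huniv, (PMF.toOuterMeasure_apply_eq_one_iff _ _).2 (Set.subset_univ _)]
    exact ENNReal.ofReal_le_one.2 (by linarith)
  have hrN : r ≤ min N₁ N₂ := hr ▸ numNonzeroTubes_le Θ
  have hr' : (1 : ℝ) ≤ r := by exact_mod_cast hr0
  set β : ℝ := μ₀ * r / N₁ with hβ
  have hrow := sum_norm_blk_le_of_coherence_le hr0 hμ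
  have hW : ∀ k, ∀ z ∈ colSpace U r k, ∀ i, ‖z i‖ ^ 2 ≤ β * ‖z‖ ^ 2 := fun k z hz i =>
    norm_apply_sq_le_of_mem_colSpace hT.left_orthogonal (hrow i k) hz
  -- A unit vector in the column space has N₁ squared entries of size at most β. Hence also μ₀r ≥ 1.
  have hNβ : 1 ≤ N₁ * β := by
    let c : Fin N₁ := ⟨0, hN₁⟩
    have hc : blk 0 (lateral U c) ∈ colSpace U r 0 :=
      Submodule.subset_span ⟨c, by simpa [c] using hr0, rfl⟩
    have hn : ‖blk 0 (lateral U c)‖ = 1 := (orthonormal_blk_lateral hT.left_orthogonal 0).1 c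
    have h1 : ‖blk 0 (lateral U c)‖ ^ 2 ≤ ∑ _i : Fin N₁, β := by
      rw [EuclideanSpace.norm_sq_eq]
      refine Finset.sum_le_sum fun i _ => ?_
      simpa [hn] using hW 0 _ hc i
    rw [hn] at h1
    simpa using h1
  have hNβ' : N₁ * β = μ₀ * r := by rw [hβ]; field_simp
  have hβ0 : 0 < β := by
    by_contra hneg
    have := mul_nonpos_of_nonneg_of_nonpos (zero_le_one.trans hN₁') (not_lt.1 hneg)
    linarith
  set D := μ₀ * r with hD
  rw [hNβ'] at hNβ
  have hD0 : 0 < D := by linarith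
  have hμ0 : 0 < μ₀ := by
    by_contra hneg
    have := mul_nonpos_of_nonpos_of_nonneg (not_lt.1 hneg) (zero_le_one.trans hr')
    linarith
  set lg := Real.log (N₂ / ρ) with hlg
  have hlg1 : 1 ≤ lg := by
    rw [hlg, Real.le_log_iff_exp_le (by positivity), le_div_iff₀ hρ]
    have := Real.exp_one_lt_d9
    nlinarith
  have hlg' : lg ≤ Real.log (r * N₂ / ρ) := by
    refine Real.log_le_log (by positivity) ?_
    gcongr
    nlinarith
  set m := ⌊δ * M / N₂⌋₊ with hm
  -- Only the logarithmic summand of the budget is kept, with its second logarithm lowered to the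
  -- first. The gap between the constants covers the rounding of m.
  have hmbig : 1500000 * (D * lg ^ 2) ≤ m := by
    have h1 : 2000000 / δ * r * N₂ * (μ₀ * lg * lg) ≤ M := by
      refine le_trans ?_ hM
      rw [budget, ← hlg]
      have h2 : 0 ≤ (⌈Real.log ((N₁ : ℝ) * N₂ * N₃)⌉ : ℝ) ^ 2 / (ρ * ε) := by positivity
      have h3 : μ₀ * lg * lg ≤ μ₀ * lg * Real.log (r * N₂ / ρ) := by gcongr
      have h4 : 0 ≤ 2000000 / δ * r * N₂ := by positivity
      exact mul_le_mul_of_nonneg_left (by linarith) h4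
    have h2 : 2000000 * (D * lg ^ 2) ≤ δ * M / N₂ := by
      rw [le_div_iff₀ (by linarith)]
      calc 2000000 * (D * lg ^ 2) * N₂ = δ * (2000000 / δ * r * N₂ * (μ₀ * lg * lg)) := by
            rw [hD]; field_simp
        _ ≤ δ * M := by gcongr
    have h3 := Nat.lt_floor_add_one (δ * M / N₂)
    rw [← hm] at h3
    have h4 : 1 ≤ D * lg ^ 2 := by nlinarith
    linarith
  set G := ⌈80 * lg⌉₊ with hG
  have hG80 : 80 * lg ≤ G := Nat.le_ceil _
  have hG81 : (G : ℝ) ≤ 81 * lg := by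
    have := Nat.ceil_lt_add_one (by linarith : 0 ≤ 80 * lg)
    linarith
  have hG0' : (0 : ℝ) < G := by linarith
  have hG0 : 0 < G := by exact_mod_cast hG0'
  have hlgsq : lg ≤ lg ^ 2 := by nlinarith
  have hν : 1500000 * lg ^ 2 ≤ m / D := by
    rw [le_div_iff₀ hD0]; linarith
  have hm20 : 20 * G ≤ m := by
    have h1 : lg ^ 2 ≤ D * lg ^ 2 := le_mul_of_one_le_left (sq_nonneg _) hNβ
    have : (20 * G : ℝ) ≤ m := by linarith
    exact_mod_cast this
  have hm0 : 0 < m := by omega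
  set p : ℝ := 3 * (ρ / N₂) ^ 2 with hp
  have hpr : ∀ (j : Fin N₂) (h : List (Finset (Fin N₂))),
      pr (fun ω : Fin m → Fin N₁ => ¬ IsAccurate T (estSubspace T h) j ω) ≤ p := by
    intro j h
    have h1 := pr_not_sampledSq_mem_le (T := T) (K := estSubspace T h) (j := j) (W := colSpace U r)
      (finrank_colSpace_le U r) hβ0 (hNβ'.symm ▸ hNβ) hW
      (fun x hx c => sliceMul_mem_estSubspace T c h hx)
      (fun x hx k => blk_mem_of_mem_estSubspace hcol h hx k) (hcol j) hG0 hm20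
    refine h1.trans ?_
    rw [hNβ']
    refine failure_le hN₂ (hrN.trans (min_le_right _ _)) hρ hρ' hG80 ?_ ?_
    -- The constant 1500000 exceeds 11 · 1600 · 81, where 81 comes from rounding up G.
    · rw [← hlg, le_div_iff₀ (by positivity)]
      have : lg * G ≤ lg * (81 * lg) := by gcongr
      nlinarith
    · rw [← hlg]; linarith
  set good : Set ((Fin N₂ → Fin m → Fin N₁) × List (Finset (Fin N₂))) :=
    {x | ∀ h : List (Finset (Fin N₂)), h <:+ x.2 → residualSq T (estSubspace T h) ≠ 0 →
      ∀ j : Fin N₂, 2 / 5 * trueProb T (estSubspace T h) j ≤ estProb T x.1 (estSubspace T h) j ∧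
        estProb T x.1 (estSubspace T h) j ≤ 5 / 2 * trueProb T (estSubspace T h) j} with hgood
  let bad : Fin N₂ → Set ((Fin N₂ → Fin m → Fin N₁) × List (Finset (Fin N₂))) := fun j =>
    {x | ∃ h, h <:+ x.2 ∧ ¬ IsAccurate T (estSubspace T h) j (x.1 j)}
  set P := (algorithmLaw T M δ L).toOuterMeasure with hP
  have hcover : Set.univ ⊆ good ∪ ⋃ j, bad j := by
    intro x _
    by_contra hx
    rw [Set.mem_union, Set.mem_iUnion, not_or] at hx
    refine hx.1 fun h hs hne j => ratio_bounds hm0 (fun j' => ?_) hne j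
    by_contra hj'
    exact hx.2 ⟨j', h, hs, hj'⟩
  have hone : 1 ≤ P good + ∑ j, P (bad j) := by
    calc 1 = P Set.univ := ((PMF.toOuterMeasure_apply_eq_one_iff _ _).2 (Set.subset_univ _)).symm
      _ ≤ P (good ∪ ⋃ j, bad j) := MeasureTheory.measure_mono hcover
      _ ≤ P good + P (⋃ j, bad j) := MeasureTheory.measure_union_le _ _
      _ ≤ _ := by
        gcongr
        simpa using MeasureTheory.measure_iUnion_fintype_le P bad
  have hbad : ∑ j, P (bad j) ≤ ENNReal.ofReal (6 * ρ) := by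
    calc ∑ j, P (bad j) ≤ ∑ _j : Fin N₂, ENNReal.ofReal p * (N₂ + 1) :=
          Finset.sum_le_sum fun j _ => toOuterMeasure_not_isAccurate_le T _ L j (hpr j)
      _ = ENNReal.ofReal (N₂ * (p * (N₂ + 1))) := by
          rw [Finset.sum_const, Finset.card_univ, Fintype.card_fin, nsmul_eq_mul,
            ENNReal.ofReal_mul (p := (N₂ : ℝ)) (by positivity),
            ENNReal.ofReal_mul (p := p) (by positivity),
            ENNReal.ofReal_natCast, ENNReal.ofReal_add (by positivity) zero_le_one,
            ENNReal.ofReal_natCast, ENNReal.ofReal_one]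
      _ ≤ _ := by
          refine ENNReal.ofReal_le_ofReal ?_
          -- The square in p pays for both the union over columns and the number of new histories.
          calc N₂ * (p * (N₂ + 1)) ≤ N₂ * (p * (2 * N₂)) := by gcongr; linarith
            _ = 6 * ρ * ρ := by rw [hp]; field_simp; norm_num
            _ ≤ 6 * ρ * 1 := by gcongr; linarith
            _ = 6 * ρ := mul_one _
  rw [ENNReal.ofReal_sub _ (by positivity), ENNReal.ofReal_one, tsub_le_iff_right]
  exact hone.trans (by gcongr)

theorem mainTheorem2 (δ : ℝ) (hδ₀ : 0 < δ) (hδ₁ : δ < 1) :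
    ∃ C : ℝ, 0 < C ∧
      (∀ (N₁ N₂ N₃ : ℕ) [NeZero N₁] [NeZero N₂] [NeZero N₃]
        (T : Tensor N₁ N₂ N₃) (U : Tensor N₁ N₁ N₃) (Θ : Tensor N₁ N₂ N₃) (V : Tensor N₂ N₂ N₃)
        (r : ℕ) (μ₀ ρ ε M : ℝ) (L : ℕ),
        Tensor.IsTSVD T U Θ V → Tensor.numNonzeroTubes Θ = r →
        Tensor.coherence U r ≤ μ₀ →
        0 < ρ → ρ < 1 → 0 < ε → ε < 1 →
        AdaptiveSampling.budget C N₁ N₂ N₃ r μ₀ ρ ε ≤ M →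
        ENNReal.ofReal (1 - 6 * ρ) ≤
          (AdaptiveSampling.algorithmLaw T M δ L).toOuterMeasure
            {x | ∀ h : List (Finset (Fin N₂)), h <:+ x.2 →
              AdaptiveSampling.residualSq T (AdaptiveSampling.estSubspace T h) ≠ 0 →
              ∀ j : Fin N₂,
                2 / 5 * AdaptiveSampling.trueProb T (AdaptiveSampling.estSubspace T h) j ≤
                    AdaptiveSampling.estProb T x.1 (AdaptiveSampling.estSubspace T h) j ∧
                  AdaptiveSampling.estProb T x.1 (AdaptiveSampling.estSubspace T h) j ≤
                    5 / 2 * AdaptiveSampling.trueProb T (AdaptiveSampling.estSubspace T h) j}) ∧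
      (∀ μ₀ ρ ε : ℝ, 0 < μ₀ → 0 < ρ → ρ < 1 → 0 < ε → ε < 1 →
        ∃ K : ℝ, 0 < K ∧ ∀ N₁ N₂ N₃ r : ℕ, 1 ≤ N₁ → 1 ≤ N₂ → 1 ≤ N₃ →
          2 ≤ max N₁ N₂ → N₃ ≤ max N₁ N₂ → r ≤ min N₁ N₂ →
          AdaptiveSampling.budget C N₁ N₂ N₃ r μ₀ ρ ε ≤
            K * ((max N₁ N₂ : ℕ) * r * Real.log (max N₁ N₂ : ℕ) ^ 2)) := by
  refine ⟨2000000 / δ, by positivity, ?_, ?_⟩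
  · intro N₁ N₂ N₃ _ _ _ T U Θ V r μ₀ ρ ε M L hT hr hμ hρ _ hε _ hM
    exact AdaptiveSampling.ofReal_le_toOuterMeasure_algorithmLaw hδ₀ L hT hr hμ hρ hε hM
  · intro μ₀ ρ ε hμ hρ hρ' hε _
    exact AdaptiveSampling.budget_le (by positivity) hμ hρ hρ' hε
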